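/- Let $\mathbb F_q$ be a finite field and let $\mathfrak n$ be a finite-dimensional, nilpotent, associative $\mathbb F_q$-algebra (without unit) with dual space $\mathfrak n^*$. Let $G = 1+\mathfrak n$ be the group of formal sums $1+X$, $X\in\mathfrak n$, with product $(1+X)(1+Y)=1+X+Y+XY$; likewise, each subalgebra $\mathfrak h\subset\mathfrak n$ gives a group $1+\mathfrak h$. Fix a nontrivial homomorphism $\theta$ from the additive group of $\mathbb F_q$ to $\mathbb C^\times$. For $\lambda\in\mathfrak n^*$ the coadjoint orbit of $\lambda$ is $\lambda^G=\{\,X\mapsto\lambda(gXg^{-1}) : g\in G\,\}\subset\mathfrak n^*$, and the Kirillov function $\psi_\lambda : G\to\mathbb C$ is $$\psi_\lambda(1+X)=\frac1{\sqrt{|\lambda^G|}}\sum_{\nu\in\lambda^G}\theta(\nu(X)),\qquad X\in\mathfrak n.$$ Let $a_k\in\mathbb F_q$ ($k\ge 2$) be scalars, all but finitely many equal to zero, and let $F(X)=1+X+\sum_{k\ge2}a_kX^k$. The map $F:\mathfrak n\to G$ is a bijection, and restricts to a bijection $\mathfrak h\to 1+\mathfrak h$ for every subalgebra $\mathfrak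 h\subset \mathfrak n$. For a complex-valued function $\psi$ on $1+\mathfrak h$ define $\psi^F : 1+\mathfrak h\to\mathbb C$ by $\psi^F(F(X))=\psi(1+X)$ for $X\in\mathfrak h$. For $\lambda\in\mathfrak n^*$ define subspaces of $\mathfrak n$ by $\mathfrak s_\lambda^0=\mathfrak n$ and, for $i\ge0$, $$\mathfrak l_\lambda^{i+1}=\{X\in\mathfrak s_\lambda^i:\lambda(XY)=0\ \text{for all } Y\in\mathfrak s_\lambda^i\},\qquad \mathfrak s_\lambda^{i+1}=\{X\in\mathfrak s_\lambda^i:\lambda(XY)=0\ \text{for all } Y\in\mathfrak l_\lambda^{i+1}\}.$$ The $\mathfrak s_\lambda^i$ form a descending chain of subalgebras of $\mathfrak n$, which is eventually constant; let $\overline{\mathfrak s}_\lambda$ be its terminal element and $\overline S_\lambda=1+\overline{\mathfrak s}_\lambda$. Then for every $\lambda\in\mathfrak n^*$, with $\mu\in(\overline{\mathfrak s}_\lambda)^*$ the restriction of $\lambda$ to $\overline{\mathfrak s}_\lambda$ and $\psi_\mu$ the Kirillov function of the group $\overline S_\lambda$ attached to $\mu$: the function $\psi_\lambda^F$ is an irreducible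 complex character of $G$ if and only if $\psi_\mu^F$ is an irreducible complex character of $\overline S_\lambda$. -/

import Mathlib

namespace AlgebraGroups

noncomputable section

section Basic

variable (K n : Type*) [Field K] [NonUnitalRing n] [Module K n]

/-- `algPow K n k` is the power `n ^ (k + 1)` of the algebra `n`: the span of all products of
`k + 1` elements. -/
def algPow : ℕ → Submodule K n
  | 0 => ⊤
  | k + 1 => Submodule.span K {z : n | ∃ x ∈ algPow k, ∃ y : n, z = x * y}

/-- The algebra `n` is nilpotent: some power `n ^ (k + 1)` vanishes. -/
class IsNilpotentAlgebra : Prop where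
  exists_algPow_eq_bot : ∃ k : ℕ, algPow K n k = ⊥

variable [IsScalarTower K n n] [SMulCommClass K n n]

/-- The algebra group `1 + n`: the invertible elements with scalar part `1` of the unitization
`K ⊕ n`. If `n` is nilpotent these are all the sums `1 + X` with `X ∈ n`, see `oneAdd`. -/
abbrev AlgebraGroup : Type _ :=
  (Units.map (Unitization.fstHom K n : Unitization K n →* K)).ker

end Basic

section Nilpotent

variable {K n : Type*} [Field K] [NonUnitalRing n] [Module K n]

lemma mul_mem_algPow [IsScalarTower K n n] [SMulCommClass K n n] (x : n) {z : n} {k : ℕ}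
    (hz : z ∈ algPow K n k) : x * z ∈ algPow K n (k + 1) := by
  induction k generalizing z with
  | zero => exact Submodule.subset_span ⟨x, Submodule.mem_top, z, rfl⟩
  | succ k ih =>
    refine Submodule.span_induction (p := fun z _ => x * z ∈ algPow K n (k + 1 + 1))
      ?_ (by simp) ?_ ?_ hz
    · rintro _ ⟨a, ha, b, rfl⟩
      exact Submodule.subset_span ⟨x * a, ih ha, b, (mul_assoc _ _ _).symm⟩
    · intro a b _ _ ha hb
      rw [mul_add]
      exact add_mem ha hb
    · intro c a _ ha
      rw [mul_smul_comm]
      exact Submodule.smul_mem _ c ha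

lemma algPow_mul_mem {z : n} {k : ℕ} (hz : z ∈ algPow K n k) (y : n) :
    z * y ∈ algPow K n (k + 1) :=
  Submodule.subset_span ⟨z, hz, y, rfl⟩

lemma algPow_succ_le (k : ℕ) : algPow K n (k + 1) ≤ algPow K n k := by
  induction k with
  | zero => exact le_top
  | succ k ih =>
    refine Submodule.span_mono ?_
    rintro _ ⟨x, hx, y, rfl⟩
    exact ⟨x, ih hx, y, rfl⟩

variable [IsScalarTower K n n] [SMulCommClass K n n]

instance subalgebra_isNilpotentAlgebra [IsNilpotentAlgebra K n] (s : NonUnitalSubalgebra K n) :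
    IsNilpotentAlgebra K s := by
  obtain ⟨k, hk⟩ := IsNilpotentAlgebra.exists_algPow_eq_bot (K := K) (n := n)
  have key : ∀ j : ℕ, ∀ z ∈ algPow K s j, (z : n) ∈ algPow K n j := by
    intro j
    induction j with
    | zero => intro z _; exact Submodule.mem_top
    | succ j ih =>
      intro z hz
      refine Submodule.span_induction (p := fun (z : s) _ => (z : n) ∈ algPow K n (j + 1))
        ?_ (by simp) ?_ ?_ hz
      · rintro _ ⟨a, ha, b, rfl⟩
        exact algPow_mul_mem (ih a ha) (b : n)
      · intro a b _ _ ha hb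
        exact add_mem ha hb
      · intro c a _ ha
        exact Submodule.smul_mem _ c ha
  refine ⟨k, (Submodule.eq_bot_iff _).2 fun z hz => ?_⟩
  have := key k z hz
  rw [hk, Submodule.mem_bot] at this
  exact Subtype.ext this

instance subalgebra_finiteDimensional [FiniteDimensional K n] (s : NonUnitalSubalgebra K n) :
    FiniteDimensional K s :=
  inferInstanceAs (FiniteDimensional K s.toSubmodule)

lemma inr_pow_mem (X : n) (k : ℕ) :
    ∃ z ∈ algPow K n k, (X : Unitization K n) ^ (k + 1) = (z : Unitization K n) := by
  induction k with
  | zero => exact ⟨X, Submodule.mem_top, by simp⟩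
  | succ k ih =>
    obtain ⟨z, hz, h⟩ := ih
    exact ⟨z * X, algPow_mul_mem hz X, by rw [pow_succ, h, Unitization.inr_mul]⟩

lemma isNilpotent_inr [IsNilpotentAlgebra K n] (X : n) : IsNilpotent (X : Unitization K n) := by
  obtain ⟨k, hk⟩ := IsNilpotentAlgebra.exists_algPow_eq_bot (K := K) (n := n)
  obtain ⟨z, hz, h⟩ := inr_pow_mem (K := K) X k
  rw [hk, Submodule.mem_bot] at hz
  exact ⟨k + 1, by rw [h, hz, Unitization.inr_zero]⟩

/-- The bijection `X ↦ 1 + X` from `n` to the algebra group `1 + n`. -/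
def oneAdd (K n : Type*) [Field K] [NonUnitalRing n] [Module K n] [IsScalarTower K n n]
    [SMulCommClass K n n] [IsNilpotentAlgebra K n] : n ≃ AlgebraGroup K n where
  toFun X := ⟨(isNilpotent_inr (K := K) X).isUnit_one_add.unit, by
    rw [MonoidHom.mem_ker]
    ext
    simp⟩
  invFun g := (g : (Unitization K n)ˣ).val.snd
  left_inv X := by simp
  right_inv g := by
    have hg : (g : (Unitization K n)ˣ).val.fst = 1 := by
      have := congrArg Units.val (MonoidHom.mem_ker.1 g.2)
      simpa using this
    ext
    · simp [hg]
    · simp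

/-- The difference `X ^ k - Y ^ k` of powers lies one step deeper than `X - Y` if `2 ≤ k`. -/
lemma inr_pow_sub_pow_mem {X Y : n} {j : ℕ} (h : X - Y ∈ algPow K n j) (k : ℕ) :
    ∃ z ∈ algPow K n (j + 1),
      (X : Unitization K n) ^ (k + 2) - (Y : Unitization K n) ^ (k + 2) = (z : Unitization K n) := by
  induction k with
  | zero =>
    refine ⟨X * (X - Y) + (X - Y) * Y, add_mem (mul_mem_algPow X h) (algPow_mul_mem h Y), ?_⟩
    simp only [Unitization.inr_add, Unitization.inr_mul, Unitization.inr_sub]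
    noncomm_ring
  | succ k ih =>
    obtain ⟨z, hz, e⟩ := ih
    obtain ⟨w, -, e'⟩ := inr_pow_mem (K := K) Y (k + 1)
    refine ⟨X * z + (X - Y) * w,
      add_mem (algPow_succ_le _ (mul_mem_algPow X hz)) (algPow_mul_mem h w), ?_⟩
    simp only [Unitization.inr_add, Unitization.inr_mul, Unitization.inr_sub, ← e, ← e']
    rw [pow_succ' _ (k + 2), pow_succ' _ (k + 2)]
    noncomm_ring

lemma aeval_sub_mem (p : Polynomial K) (h1 : p.coeff 1 = 1) {X Y : n} {j : ℕ}
    (h : X - Y ∈ algPow K n j) :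
    ∃ z ∈ algPow K n (j + 1),
      Polynomial.aeval (X : Unitization K n) p - Polynomial.aeval (Y : Unitization K n) p =
        ((X - Y + z : n) : Unitization K n) := by
  choose f hf hf' using inr_pow_sub_pow_mem (K := K) h
  refine ⟨∑ k ∈ Finset.range p.natDegree, p.coeff (k + 2) • f k,
    Submodule.sum_mem _ fun k _ => Submodule.smul_mem _ _ (hf k), ?_⟩
  have hd : p.natDegree < p.natDegree + 2 := by omega
  have hsum : ((∑ k ∈ Finset.range p.natDegree, p.coeff (k + 2) • f k : n) : Unitization K n) =
      ∑ k ∈ Finset.range p.natDegree, p.coeff (k + 2) • (f k : Unitization K n) :=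
    (map_sum (Unitization.inrHom K K n) _ _).trans
      (Finset.sum_congr rfl fun k _ => map_smul (Unitization.inrHom K K n) _ _)
  rw [Polynomial.aeval_eq_sum_range' hd, Polynomial.aeval_eq_sum_range' hd,
    Finset.sum_range_succ', Finset.sum_range_succ', Finset.sum_range_succ' _ (p.natDegree + 1),
    Finset.sum_range_succ' _ p.natDegree, Unitization.inr_add, hsum, Unitization.inr_sub]
  simp only [← hf', smul_sub, Finset.sum_sub_distrib, zero_add, h1, one_smul, pow_one, pow_zero]
  abel

/-- The polynomial map `F(X) = ∑ a_k X ^ k` from `n` to `1 + n`, for a polynomial `p = ∑ a_k x ^ k`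
with `a_0 = 1`; see `polyMap_val`. -/
def polyMap [IsNilpotentAlgebra K n] (p : Polynomial K) (X : n) : AlgebraGroup K n :=
  oneAdd K n (Polynomial.aeval (X : Unitization K n) p).snd

lemma aeval_inr_fst (p : Polynomial K) (X : n) :
    (Polynomial.aeval (X : Unitization K n) p).fst = p.coeff 0 := by
  have h : (Unitization.fstHom K n) (Polynomial.aeval (X : Unitization K n) p) =
      Polynomial.aeval ((Unitization.fstHom K n) (X : Unitization K n)) p :=
    (Polynomial.aeval_algHom_apply _ _ _).symm
  simpa [Polynomial.coeff_zero_eq_aeval_zero] using h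

/-- In the unitization, `polyMap p X` is literally the value of the polynomial `p` at `X`. -/
lemma polyMap_val [IsNilpotentAlgebra K n] (p : Polynomial K) (h0 : p.coeff 0 = 1) (X : n) :
    ((polyMap p X : AlgebraGroup K n) : (Unitization K n)ˣ).val =
      Polynomial.aeval (X : Unitization K n) p := by
  ext
  · simp [polyMap, oneAdd, aeval_inr_fst, h0]
  · simp [polyMap, oneAdd]

lemma polyMap_bijective [Finite K] [FiniteDimensional K n] [IsNilpotentAlgebra K n]
    (p : Polynomial K) (h0 : p.coeff 0 = 1) (h1 : p.coeff 1 = 1) :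
    Function.Bijective (polyMap p : n → AlgebraGroup K n) := by
  have : Finite n := Module.finite_of_finite K
  have hinj : Function.Injective (polyMap p : n → AlgebraGroup K n) := by
    intro X Y hXY
    have he : Polynomial.aeval (X : Unitization K n) p =
        Polynomial.aeval (Y : Unitization K n) p := by
      rw [← polyMap_val p h0, ← polyMap_val p h0, hXY]
    have hall : ∀ j, X - Y ∈ algPow K n j := by
      intro j
      induction j with
      | zero => exact Submodule.mem_top
      | succ j ih =>
        obtain ⟨z, hz, e⟩ := aeval_sub_mem p h1 ih
        rw [he, sub_self] at e
        have e' : X - Y + z = 0 :=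
          Unitization.inr_injective (R := K) (e.symm.trans (Unitization.inr_zero K).symm)
        rw [eq_neg_of_add_eq_zero_left e']
        exact neg_mem hz
    obtain ⟨k, hk⟩ := IsNilpotentAlgebra.exists_algPow_eq_bot (K := K) (n := n)
    have := hall k
    rw [hk, Submodule.mem_bot] at this
    exact sub_eq_zero.1 this
  have : Finite (AlgebraGroup K n) := Finite.of_equiv n (oneAdd K n)
  exact hinj.bijective_of_nat_card_le (Nat.card_congr (oneAdd K n)).ge

/-- A polynomial with constant and linear coefficient `1` defines a bijection
`F(X) = 1 + X + ∑_{k ≥ 2} a_k X ^ k` from `n` onto `1 + n`. -/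
def polyEquiv (n : Type*) [NonUnitalRing n] [Module K n] [IsScalarTower K n n]
    [SMulCommClass K n n] [Finite K] [FiniteDimensional K n] [IsNilpotentAlgebra K n]
    (p : Polynomial K) (h0 : p.coeff 0 = 1) (h1 : p.coeff 1 = 1) : n ≃ AlgebraGroup K n :=
  Equiv.ofBijective (polyMap p) (polyMap_bijective p h0 h1)

/-- For a bijection `F : n → 1 + n` and `ψ : 1 + n → ℂ`, the function `ψ ^ F` with
`ψ ^ F (F X) = ψ (1 + X)`. -/
def twist [IsNilpotentAlgebra K n] (F : n ≃ AlgebraGroup K n) (ψ : AlgebraGroup K n → ℂ) :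
    AlgebraGroup K n → ℂ :=
  fun g => ψ (oneAdd K n (F.symm g))

end Nilpotent

section Kirillov

variable {K n : Type*} [Field K] [NonUnitalRing n] [Module K n]
  [IsScalarTower K n n] [SMulCommClass K n n]

/-- The linear map `X ↦ g X g⁻¹` on `n`, for `g ∈ 1 + n`. -/
def conjMap (g : AlgebraGroup K n) : n →ₗ[K] n :=
  Unitization.sndHom K K n ∘ₗ
    LinearMap.mulLeft K ((g : (Unitization K n)ˣ) : Unitization K n) ∘ₗ
    LinearMap.mulRight K (((g⁻¹ : AlgebraGroup K n) : (Unitization K n)ˣ) : Unitization K n) ∘ₗ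
    Unitization.inrHom K K n

/-- In the unitization, `conjMap g X` is literally the product `g X g⁻¹`. -/
lemma inr_conjMap (g : AlgebraGroup K n) (X : n) :
    (conjMap g X : Unitization K n) =
      (g : (Unitization K n)ˣ).val * (X : Unitization K n) * (g : (Unitization K n)ˣ)⁻¹.val := by
  ext
  · simp
  · simp [conjMap, mul_assoc]

/-- The coadjoint orbit of `lam`: all the functionals `X ↦ lam (g X g⁻¹)` with `g ∈ 1 + n`. -/
def coadjointOrbit (lam : Module.Dual K n) : Set (Module.Dual K n) :=
  Set.range fun g : AlgebraGroup K n => lam ∘ₗ conjMap g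

/-- The function `θ_lam (g) = θ (lam (g - 1))` on `1 + n`. -/
def thetaFun (θ : AddChar K ℂ) (lam : Module.Dual K n) (g : AlgebraGroup K n) : ℂ :=
  θ (lam (g : (Unitization K n)ˣ).val.snd)

/-- The Kirillov function of `lam`: the sum of `θ_μ` over the (finite) coadjoint orbit of `lam`,
divided by the square root of the size of the orbit. -/
def kirillov (θ : AddChar K ℂ) (lam : Module.Dual K n) (g : AlgebraGroup K n) : ℂ :=
  ((Real.sqrt ((coadjointOrbit lam).ncard : ℝ) : ℝ) : ℂ)⁻¹ *
    ∑ᶠ μ ∈ coadjointOrbit lam, thetaFun θ μ g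

/-- The left kernel of the bilinear form `(X, Y) ↦ lam (X Y)` on `s × s`. -/
def leftKer (lam : Module.Dual K n) (s : NonUnitalSubalgebra K n) : Set n :=
  {X | X ∈ s ∧ ∀ Y ∈ s, lam (X * Y) = 0}

/-- The left kernel of the bilinear form `(X, Y) ↦ lam (X Y)` on `s × l`, where `l` is
`leftKer lam s`. -/
def nextSubalgebra (lam : Module.Dual K n) (s : NonUnitalSubalgebra K n) :
    NonUnitalSubalgebra K n where
  carrier := {X | X ∈ s ∧ ∀ Y ∈ leftKer lam s, lam (X * Y) = 0}
  add_mem' := by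
    rintro a b ⟨ha, ha'⟩ ⟨hb, hb'⟩
    exact ⟨add_mem ha hb, fun Y hY => by rw [add_mul, map_add, ha' Y hY, hb' Y hY, add_zero]⟩
  zero_mem' := ⟨zero_mem s, fun Y _ => by rw [zero_mul, map_zero]⟩
  smul_mem' := by
    rintro c a ⟨ha, ha'⟩
    exact ⟨SMulMemClass.smul_mem c ha, fun Y hY => by rw [smul_mul_assoc, map_smul, ha' Y hY, smul_zero]⟩
  mul_mem' := by
    rintro a b ⟨ha, ha'⟩ ⟨hb, hb'⟩
    refine ⟨mul_mem ha hb, fun Y hY => ?_⟩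
    rw [mul_assoc]
    refine ha' _ ⟨mul_mem hb hY.1, fun Z hZ => ?_⟩
    rw [mul_assoc]
    refine hb' _ ⟨mul_mem hY.1 hZ, fun W hW => ?_⟩
    rw [mul_assoc]
    exact hY.2 _ (mul_mem hZ hW)

/-- The descending chain of subalgebras `n = s ^ 0 ⊇ s ^ 1 ⊇ s ^ 2 ⊇ ⋯` attached to `lam`. -/
def sChain (lam : Module.Dual K n) : ℕ → NonUnitalSubalgebra K n
  | 0 => ⊤
  | i + 1 => nextSubalgebra lam (sChain lam i)

/-- The terminal element of the chain `sChain lam`, written as its intersection; see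
`sBar_eq_sChain`. -/
def sBar (lam : Module.Dual K n) : NonUnitalSubalgebra K n :=
  ⨅ i, sChain lam i

lemma sChain_antitone (lam : Module.Dual K n) : Antitone (sChain lam) :=
  antitone_nat_of_succ_le fun _ _ hX => hX.1

/-- As soon as the chain repeats, it is constant, with value `sBar lam`. -/
lemma sBar_eq_sChain (lam : Module.Dual K n) {d : ℕ} (h : sChain lam (d + 1) = sChain lam d) :
    sBar lam = sChain lam d := by
  have hc : ∀ i, sChain lam (d + i) = sChain lam d := by
    intro i
    induction i with
    | zero => rfl
    | succ i ih =>
      change nextSubalgebra lam (sChain lam (d + i)) = _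
      rw [ih]
      exact h
  refine le_antisymm (iInf_le _ d) (le_iInf fun i => ?_)
  rw [← hc i]
  exact sChain_antitone lam (Nat.le_add_left i d)

lemma exists_sBar_eq_sChain [FiniteDimensional K n] (lam : Module.Dual K n) :
    ∃ d, sChain lam (d + 1) = sChain lam d ∧ sBar lam = sChain lam d := by
  obtain ⟨d, hd⟩ := IsArtinian.monotone_stabilizes (R := K) (M := n)
    ⟨fun i => OrderDual.toDual (sChain lam i).toSubmodule,
      fun i j hij x hx => sChain_antitone lam hij hx⟩
  have h : sChain lam (d + 1) = sChain lam d :=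
    (NonUnitalSubalgebra.toSubmodule_injective (hd (d + 1) d.le_succ)).symm
  exact ⟨d, h, sBar_eq_sChain lam h⟩

/-- The restriction of a linear functional to a subalgebra. -/
def restrictDual (lam : Module.Dual K n) (s : NonUnitalSubalgebra K n) : Module.Dual K s :=
  lam ∘ₗ s.toSubmodule.subtype

end Kirillov

/-- `f` is an irreducible complex character of the group `G`. -/
def IsIrrChar {G : Type*} [Group G] (f : G → ℂ) : Prop :=
  ∃ (d : ℕ) (ρ : Representation ℂ G (Fin d → ℂ)), ρ.IsIrreducible ∧ ρ.character = f

end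

end AlgebraGroups

set_option linter.unusedSectionVars false

/-! The chain becomes stationary, so it suffices to pass from `n` to its first subalgebra and
iterate. Let `l` be the left kernel of `(X, Y) ↦ lam (X Y)` and `s` the set of `X` with `lam (X l) =
0`. Then `l` is a two-sided ideal of `s` and `lam` vanishes on `l s` and `s l`. So `N = 1 + l` is
normal in `H = 1 + s`, and `τ (1 + w) = θ (lam w)` is an `H`-invariant linear character of `N`. For
`g ∉ H`, some `x ∈ N` has `g x g⁻¹ ∈ N` with a different value of `τ` (`IsStep.mackey`). The
idempotent `E` of `τ` therefore commutes with `H` and satisfies `E g E = 0` for `g ∉ H`. Taking the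
range of `E` matches irreducible representations of `G` with `E ≠ 0` with those of `H` lying over
`τ`. On characters this is averaging against `τ` in one direction and induction in the other
(`isIrrChar_iff_of_mackey`). It remains to relate the two twisted Kirillov functions by these
formulas. Written as sums over the group (`kirillov_oneAdd`), they have the same normalising
constant (`card_mul_card_radical`). Orthogonality of additive characters on `l` gives the averaging
formula (`IsStep.sum_kernel_mul_sum`) and the induction formula (`IsStep.sum_extend_sum`). The twist
does no harm: `F` commutes with conjugation and inclusions, and `F(x)⁻¹ F(x + w)`, `w ∈ l`, runs
over `N` with `τ`-value `θ (lam w)`. -/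

namespace AlgebraGroups

/-! ### Irreducible representations and invariant subspaces -/

section Irreducible

variable {G V : Type*} [Group G] [AddCommGroup V] [Module ℂ V]

lemma isIrreducible_iff_forall_submodule (ρ : Representation ℂ G V) :
    ρ.IsIrreducible ↔ Nontrivial V ∧ ∀ U : Submodule ℂ V,
      (∀ g, ∀ v ∈ U, ρ g v ∈ U) → U = ⊥ ∨ U = ⊤ := by
  constructor
  · intro h
    constructor
    · by_contra hV
      rw [not_nontrivial_iff_subsingleton] at hV
      exact bot_ne_top (α := Subrepresentation ρ)
        (Subrepresentation.toSubmodule_injective (Subsingleton.elim _ _))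
    · intro U hU
      rcases eq_bot_or_eq_top (⟨U, fun g v hv => hU g v hv⟩ : Subrepresentation ρ) with h | h
      · exact Or.inl (congrArg Subrepresentation.toSubmodule h)
      · exact Or.inr (congrArg Subrepresentation.toSubmodule h)
  · rintro ⟨hV, h⟩
    refine { exists_pair_ne := ⟨⊥, ⊤, fun e => ?_⟩, eq_bot_or_eq_top := fun U => ?_ }
    · exact bot_ne_top (α := Submodule ℂ V) (congrArg Subrepresentation.toSubmodule e)
    · rcases h U.toSubmodule fun g v hv => U.apply_mem_toSubmodule g hv with h | h
      · exact Or.inl (Subrepresentation.toSubmodule_injective h)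
      · exact Or.inr (Subrepresentation.toSubmodule_injective h)

lemma isIrreducible_of_equiv {W : Type*} [AddCommGroup W] [Module ℂ W]
    {ρ : Representation ℂ G V} {σ : Representation ℂ G W} (e : V ≃ₗ[ℂ] W)
    (he : ∀ g v, e (ρ g v) = σ g (e v)) (h : ρ.IsIrreducible) : σ.IsIrreducible := by
  rw [isIrreducible_iff_forall_submodule] at h ⊢
  obtain ⟨hV, h⟩ := h
  refine ⟨e.symm.toEquiv.nontrivial, fun U hU => ?_⟩
  have hmap : (U.comap (e : V →ₗ[ℂ] W)).map (e : V →ₗ[ℂ] W) = U :=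
    Submodule.map_comap_eq_of_surjective e.surjective U
  rcases h (U.comap (e : V →ₗ[ℂ] W)) fun g v hv => by
      simp only [Submodule.mem_comap, LinearEquiv.coe_coe] at hv ⊢
      rw [he]
      exact hU g _ hv with h | h
  · left
    rw [← hmap, h, Submodule.map_bot]
  · right
    rw [← hmap, h, Submodule.map_top, LinearEquiv.range]

/-- An irreducible finite-dimensional representation is isomorphic to one on some `ℂ ^ d`. -/
lemma exists_equiv_fin [FiniteDimensional ℂ V] (ρ : Representation ℂ G V)
    (h : ρ.IsIrreducible) :
    ∃ (d : ℕ) (σ : Representation ℂ G (Fin d → ℂ)) (e : V ≃ₗ[ℂ] (Fin d → ℂ)),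
      σ.IsIrreducible ∧ ∀ g, σ g = e.conj (ρ g) := by
  let e := (Module.finBasis ℂ V).equivFun
  let σ : Representation ℂ G (Fin (Module.finrank ℂ V) → ℂ) :=
    { toFun := fun g => e.conj (ρ g)
      map_one' := by ext; simp
      map_mul' := fun a b => by
        rw [map_mul]
        exact e.conj_comp (ρ b) (ρ a) }
  refine ⟨_, σ, e, isIrreducible_of_equiv e (fun g v => ?_) h, fun g => rfl⟩
  simp [σ, LinearEquiv.conj_apply]

/-- The character of an irreducible representation on any finite-dimensional space is an
irreducible character. -/
lemma isIrrChar_character [FiniteDimensional ℂ V] (ρ : Representation ℂ G V)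
    (h : ρ.IsIrreducible) : IsIrrChar ρ.character := by
  obtain ⟨d, σ, e, hσ, he⟩ := exists_equiv_fin ρ h
  refine ⟨d, σ, hσ, funext fun g => ?_⟩
  rw [Representation.character, he]
  exact LinearMap.trace_conj' (ρ g) e

/-- A finite-dimensional nonzero representation has an irreducible subrepresentation. -/
lemma exists_irreducible_subrepresentation [FiniteDimensional ℂ V] [Nontrivial V]
    (ρ : Representation ℂ G V) :
    ∃ (d : ℕ) (σ : Representation ℂ G (Fin d → ℂ)) (i : (Fin d → ℂ) →ₗ[ℂ] V),
      σ.IsIrreducible ∧ Function.Injective i ∧ ∀ g v, i (σ g v) = ρ g (i v) := by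
  classical
  suffices hU : ∃ U : Subrepresentation ρ, U.toRepresentation.IsIrreducible by
    obtain ⟨U, hU⟩ := hU
    obtain ⟨d, σ, e, hσ, he⟩ := exists_equiv_fin _ hU
    refine ⟨d, σ, U.toSubmodule.subtype ∘ₗ e.symm, hσ,
      U.toSubmodule.injective_subtype.comp e.symm.injective, fun g v => ?_⟩
    simp only [he, LinearEquiv.conj_apply, LinearMap.comp_apply, LinearEquiv.coe_coe,
      LinearEquiv.symm_apply_apply]
    rfl
  -- A nonzero subrepresentation of least dimension is irreducible.
  have hex : ∃ d : ℕ, ∃ U : Subrepresentation ρ,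
      U.toSubmodule ≠ ⊥ ∧ Module.finrank ℂ U.toSubmodule = d :=
    ⟨_, ⊤, top_ne_bot (α := Submodule ℂ V), rfl⟩
  obtain ⟨U, hU, hd⟩ := Nat.find_spec hex
  refine ⟨U, (isIrreducible_iff_forall_submodule _).2
    ⟨Submodule.nontrivial_iff_ne_bot.2 hU, fun T hT => ?_⟩⟩
  by_contra! hcon
  let T' : Subrepresentation ρ := ⟨T.map U.toSubmodule.subtype, by
    rintro g _ ⟨v, hv, rfl⟩
    exact ⟨_, hT g v hv, rfl⟩⟩
  have hlt : Module.finrank ℂ T'.toSubmodule < Nat.find hex := by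
    rw [← hd]
    change Module.finrank ℂ (T.map U.toSubmodule.subtype) < _
    rw [Submodule.finrank_map_subtype_eq]
    exact Submodule.finrank_lt hcon.2
  refine Nat.find_min hex hlt ⟨T', fun hb => hcon.1 ?_, rfl⟩
  exact Submodule.map_injective_of_injective U.toSubmodule.injective_subtype
    (hb.trans (Submodule.map_bot _).symm)

end Irreducible

/-! ### The idempotent of a linear character -/

section CharProj

variable {G H V : Type*} [Group G] [Group H] [AddCommGroup V] [Module ℂ V]
  {N : Subgroup H} [Fintype N]

/-- The projection onto the subspace of `V` on which the subgroup `N` acts by the linear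
character `τ`. -/
noncomputable def charProj (τ : N →* ℂ) (σ : Representation ℂ H V) : V →ₗ[ℂ] V :=
  (Nat.card N : ℂ)⁻¹ • ∑ x : N, τ x⁻¹ • σ x

variable (τ : N →* ℂ) (σ : Representation ℂ H V)

lemma charProj_mul_apply (y : N) : charProj τ σ * σ y = τ y • charProj τ σ := by
  rw [charProj, smul_mul_assoc, smul_comm (τ y), Finset.sum_mul,
    Finset.smul_sum (r := τ y)]
  congr 1
  refine Fintype.sum_equiv (Equiv.mulRight y) _ _ fun x => ?_
  rw [smul_mul_assoc, smul_smul, ← map_mul, ← map_mul]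
  simp

lemma apply_mul_charProj (y : N) : σ y * charProj τ σ = τ y • charProj τ σ := by
  rw [charProj, mul_smul_comm, smul_comm (τ y), Finset.mul_sum,
    Finset.smul_sum (r := τ y)]
  congr 1
  refine Fintype.sum_equiv (Equiv.mulLeft y) _ _ fun x => ?_
  rw [mul_smul_comm, smul_smul, ← map_mul σ, mul_comm (τ y), ← map_mul τ]
  simp

lemma charProj_mul_self : charProj τ σ * charProj τ σ = charProj τ σ := by
  nth_rewrite 1 [charProj]
  rw [smul_mul_assoc, Finset.sum_mul]
  have : ∀ x : N, (τ x⁻¹ • σ x) * charProj τ σ = charProj τ σ := fun x => by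
    rw [smul_mul_assoc, apply_mul_charProj, smul_smul, ← map_mul, inv_mul_cancel, map_one,
      one_smul]
  rw [Finset.sum_congr rfl fun x _ => this x, Finset.sum_const, Finset.card_univ,
    ← Nat.card_eq_fintype_card, ← Nat.cast_smul_eq_nsmul ℂ, smul_smul, inv_mul_cancel₀, one_smul]
  exact Nat.cast_ne_zero.2 Nat.card_pos.ne'

/-- Conjugation by `h` permutes the terms of the average, and invariance of `τ` keeps their
coefficients. -/
lemma charProj_commute [N.Normal] (hτ : ∀ (h : H) (x : N), τ (MulAut.conjNormal h x) = τ x)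
    (h : H) : charProj τ σ * σ h = σ h * charProj τ σ := by
  rw [charProj, smul_mul_assoc, mul_smul_comm, Finset.sum_mul, Finset.mul_sum]
  congr 1
  refine Fintype.sum_equiv (MulAut.conjNormal h⁻¹).toEquiv _ _ fun x => ?_
  rw [smul_mul_assoc, mul_smul_comm, ← map_mul, ← map_mul]
  have := hτ h⁻¹ x⁻¹
  rw [map_inv] at this
  simp only [MulEquiv.toEquiv_eq_coe, EquivLike.coe_coe]
  rw [this]
  congr 2
  simp [mul_assoc]

lemma trace_mul_charProj (h : H) : LinearMap.trace ℂ V (σ h * charProj τ σ) =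
    (Nat.card N : ℂ)⁻¹ * ∑ x : N, τ x⁻¹ * σ.character (h * x) := by
  rw [charProj, mul_smul_comm, map_smul, Finset.mul_sum, map_sum, smul_eq_mul]
  congr 1
  refine Finset.sum_congr rfl fun x _ => ?_
  rw [mul_smul_comm, map_smul, ← map_mul]
  rfl

variable {τ}

/-- The range of `charProj τ σ`, as a representation of `H`. -/
noncomputable def charRange [N.Normal] (hτ : ∀ (h : H) (x : N), τ (MulAut.conjNormal h x) = τ x) :
    Subrepresentation σ where
  toSubmodule := LinearMap.range (charProj τ σ)
  apply_mem_toSubmodule h := by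
    rintro _ ⟨w, rfl⟩
    exact ⟨σ h w, LinearMap.congr_fun (charProj_commute τ σ hτ h) w⟩

lemma charProj_apply_of_mem_range {v : V} (hv : v ∈ LinearMap.range (charProj τ σ)) :
    charProj τ σ v = v := by
  obtain ⟨w, rfl⟩ := hv
  exact LinearMap.congr_fun (charProj_mul_self τ σ) w

/-- The operator `σ h * charProj τ σ` maps into the range and agrees there with `σ h`, so its trace
is that of its restriction. -/
lemma character_charRange [FiniteDimensional ℂ V] [N.Normal]
    (hτ : ∀ (h : H) (x : N), τ (MulAut.conjNormal h x) = τ x) (h : H) :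
    (charRange σ hτ).toRepresentation.character h =
      LinearMap.trace ℂ V (σ h * charProj τ σ) := by
  have hmem : ∀ v, (σ h * charProj τ σ) v ∈ (charRange σ hτ).toSubmodule := fun v =>
    (charRange σ hτ).apply_mem_toSubmodule h ⟨v, rfl⟩
  rw [← LinearMap.trace_restrict_eq_of_forall_mem _ _ hmem]
  refine congrArg _ (LinearMap.ext fun v => Subtype.ext ?_)
  change σ h v = σ h (charProj τ σ v)
  rw [charProj_apply_of_mem_range σ v.2]

variable {ι : H →* G} (ρ : Representation ℂ G V)

/-- In `E g x E = E y g E` the right-hand `E` absorbs `x` as `τ x` and the left-hand one absorbs `y`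
as `τ y`. -/
lemma charProj_mul_mul_charProj {g : G}
    (hg : ∃ x y : N, g * ι x = ι y * g ∧ τ x ≠ τ y) :
    charProj τ (ρ.comp ι) * ρ g * charProj τ (ρ.comp ι) = 0 := by
  obtain ⟨x, y, hxy, hne⟩ := hg
  set E := charProj τ (ρ.comp ι)
  have e1 : E * ρ g * (ρ (ι x) * E) = τ x • (E * ρ g * E) := by
    rw [show ρ (ι x) * E = τ x • E from apply_mul_charProj τ (ρ.comp ι) x, mul_smul_comm]
  have e2 : E * ρ g * (ρ (ι x) * E) = τ y • (E * ρ g * E) := by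
    rw [mul_assoc, ← mul_assoc (ρ g), ← map_mul, hxy, map_mul, mul_assoc (ρ (ι y)), ← mul_assoc E,
      show E * ρ (ι y) = τ y • E from charProj_mul_apply τ (ρ.comp ι) y, smul_mul_assoc, mul_assoc]
  have e3 : (τ x - τ y) • (E * ρ g * E) = 0 := by rw [sub_smul, ← e1, ← e2, sub_self]
  exact (smul_eq_zero.1 e3).resolve_left (sub_ne_zero.2 hne)

/-- If the Mackey condition holds outside `H`, then `charRange` turns irreducible representations
of `G` into irreducible representations of `H`. -/
lemma isIrreducible_charRange [N.Normal]
    (hτ : ∀ (h : H) (x : N), τ (MulAut.conjNormal h x) = τ x)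
    (hM : ∀ g ∉ Set.range ι, ∃ x y : N, g * ι x = ι y * g ∧ τ x ≠ τ y)
    (hρ : ρ.IsIrreducible) (hE : charProj τ (ρ.comp ι) ≠ 0) :
    (charRange (ρ.comp ι) hτ).toRepresentation.IsIrreducible := by
  rw [isIrreducible_iff_forall_submodule] at hρ ⊢
  set E := charProj τ (ρ.comp ι) with hEdef
  refine ⟨Submodule.nontrivial_iff_ne_bot.2 fun h => hE (LinearMap.range_eq_bot.1 h),
    fun U hU => ?_⟩
  rw [or_iff_not_imp_left]
  intro hU0
  -- The `G`-translates of `U` span `V`. Applying `E` brings them back into `U`: it commutes with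
  -- `H` and kills `g u` for `g ∉ H`. Since `E` is the identity on its range, `U` is the whole
  -- range.
  let T : Submodule ℂ V := Submodule.span ℂ {v | ∃ (g : G) (u : _) (_ : u ∈ U), v = ρ g u}
  have hT : T = ⊤ := by
    refine (hρ.2 T fun g v hv => ?_).resolve_left fun h => hU0 ?_
    · refine Submodule.span_induction (p := fun v _ => ρ g v ∈ T) ?_ (by simp) ?_ ?_ hv
      · rintro _ ⟨k, u, hu, rfl⟩
        exact Submodule.subset_span ⟨g * k, u, hu, by rw [map_mul]; rfl⟩
      · intro a b _ _ ha hb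
        rw [map_add]
        exact add_mem ha hb
      · intro c a _ ha
        rw [map_smul]
        exact Submodule.smul_mem _ c ha
    · refine (Submodule.eq_bot_iff _).2 fun u hu => Subtype.ext ?_
      have : (u : V) ∈ T := Submodule.subset_span ⟨1, u, hu, by simp⟩
      rw [h] at this
      simpa using this
  have hTU : ∀ v ∈ T, E v ∈ U.map (charRange (ρ.comp ι) hτ).toSubmodule.subtype := by
    intro v hv
    refine Submodule.span_induction
      (p := fun v _ => E v ∈ U.map (charRange (ρ.comp ι) hτ).toSubmodule.subtype)
      ?_ (by simp) ?_ ?_ hv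
    · rintro _ ⟨g, u, hu, rfl⟩
      have hEu : E u = u := charProj_apply_of_mem_range (ρ.comp ι) u.2
      by_cases hg : g ∈ Set.range ι
      · obtain ⟨h, rfl⟩ := hg
        refine ⟨_, hU h u hu, ?_⟩
        have := LinearMap.congr_fun (charProj_commute τ (ρ.comp ι) hτ h) u
        exact (this.trans (congrArg (ρ (ι h)) hEu)).symm
      · have := LinearMap.congr_fun (charProj_mul_mul_charProj ρ (hM g hg)) (u : V)
        simp only [Module.End.mul_apply, ← hEdef, hEu, LinearMap.zero_apply] at this
        rw [this]
        exact zero_mem _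
    · intro a b _ _ ha hb
      rw [map_add]
      exact add_mem ha hb
    · intro c a _ ha
      rw [map_smul]
      exact Submodule.smul_mem _ c ha
  refine Submodule.eq_top_iff'.2 fun v => ?_
  obtain ⟨u, hu, huv⟩ := hTU v (hT ▸ Submodule.mem_top)
  have hv : E v = v := charProj_apply_of_mem_range (ρ.comp ι) v.2
  rwa [← Subtype.ext (huv.trans hv)]

/-- Since `E` is idempotent, `g E` and `E g E` have the same trace. -/
lemma trace_mul_charProj_eq_zero [FiniteDimensional ℂ V] {g : G}
    (hg : ∃ x y : N, g * ι x = ι y * g ∧ τ x ≠ τ y) :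
    LinearMap.trace ℂ V (ρ g * charProj τ (ρ.comp ι)) = 0 := by
  rw [← charProj_mul_self, ← mul_assoc, LinearMap.trace_mul_comm, ← mul_assoc,
    charProj_mul_mul_charProj ρ hg, map_zero]

end CharProj

/-! ### Clifford correspondence under the Mackey condition -/

section Correspondence

variable {G H : Type*} [Group G] [Group H] {N : Subgroup H} [Fintype N] {τ : N →* ℂ}

/-- If the character of an irreducible representation restricts to a multiple of the linear
character `τ` on `N`, then `N` acts through `τ`. -/
lemma charProj_eq_one {W : Type*} [AddCommGroup W] [Module ℂ W] [FiniteDimensional ℂ W]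
    [N.Normal] (hτ : ∀ (h : H) (x : N), τ (MulAut.conjNormal h x) = τ x)
    (σ : Representation ℂ H W) (hσ : σ.IsIrreducible)
    (hN : ∀ x : N, σ.character x = τ x * σ.character 1) : charProj τ σ = 1 := by
  have hW := (isIrreducible_iff_forall_submodule σ).1 hσ
  -- Every term of the average equals the dimension, so the projection is nonzero; its range is
  -- invariant, hence everything.
  have htr : LinearMap.trace ℂ W (charProj τ σ) = σ.character 1 := by
    have h := trace_mul_charProj τ σ 1
    rw [map_one, one_mul] at h
    rw [h]
    have : ∀ x : N, τ x⁻¹ * σ.character (1 * x) = σ.character 1 := fun x => by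
      rw [one_mul, hN, ← mul_assoc, ← map_mul, inv_mul_cancel, map_one, one_mul]
    rw [Finset.sum_congr rfl fun x _ => this x, Finset.sum_const, Finset.card_univ,
      ← Nat.card_eq_fintype_card, nsmul_eq_mul, inv_mul_cancel_left₀]
    exact Nat.cast_ne_zero.2 Nat.card_pos.ne'
  have hne : charProj τ σ ≠ 0 := by
    intro h0
    rw [h0, map_zero, Representation.char_one] at htr
    have := hW.1
    exact Module.finrank_pos.ne' (Nat.cast_eq_zero.1 htr.symm)
  have htop : LinearMap.range (charProj τ σ) = ⊤ :=
    (hW.2 _ fun h v hv => (charRange σ hτ).apply_mem_toSubmodule h hv).resolve_left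
      fun h => hne (LinearMap.range_eq_bot.1 h)
  exact LinearMap.ext fun v => charProj_apply_of_mem_range σ (htop ▸ Submodule.mem_top)

variable {ι : H →* G}

/-- A nonzero vector `w` yields the equivariant function supported on `ι(H)` with value `σ h w` at
`ι h`. -/
lemma nontrivial_coindV {W : Type*} [AddCommGroup W] [Module ℂ W] [Nontrivial W]
    (hι : Function.Injective ι) (σ : Representation ℂ H W) :
    Nontrivial (Representation.coindV ι σ) := by
  obtain ⟨w, hw⟩ := exists_ne (0 : W)
  have hmem : Function.extend ι (fun h => σ h w) 0 ∈ Representation.coindV ι σ := by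
    intro h g
    by_cases hg : ∃ k, ι k = g
    · obtain ⟨k, rfl⟩ := hg
      rw [← map_mul, hι.extend_apply, hι.extend_apply, map_mul]
      rfl
    · rw [Function.extend_apply' _ _ _ hg, Function.extend_apply']
      · simp
      · rintro ⟨k, hk⟩
        exact hg ⟨h⁻¹ * k, by rw [map_mul, hk, ← mul_assoc, ← map_mul]; simp⟩
  refine ⟨⟨_, hmem⟩, 0, fun h => hw ?_⟩
  have := congrFun (congrArg Subtype.val h) (ι 1)
  exact (by simpa using (hι.extend_apply (fun h => σ h w) 0 1).symm.trans this)

/-- Every irreducible representation of `H` is a quotient of the restriction of an irreducible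
representation of `G`. -/
lemma exists_irreducible_intertwining [Finite G] {W : Type*} [AddCommGroup W] [Module ℂ W]
    [FiniteDimensional ℂ W] (hι : Function.Injective ι) (σ : Representation ℂ H W)
    (hσ : σ.IsIrreducible) :
    ∃ (d : ℕ) (ρ : Representation ℂ G (Fin d → ℂ)) (f : (Fin d → ℂ) →ₗ[ℂ] W),
      ρ.IsIrreducible ∧ f ≠ 0 ∧ ∀ h v, f (ρ (ι h) v) = σ h (f v) := by
  have hW := ((isIrreducible_iff_forall_submodule σ).1 hσ).1
  have := nontrivial_coindV hι σ
  obtain ⟨d, ρ, i, hρ, hi, hiρ⟩ :=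
    exists_irreducible_subrepresentation (Representation.coind ι σ)
  have hd := ((isIrreducible_iff_forall_submodule _).1 hρ).1
  -- Frobenius reciprocity: the map is evaluation at `1`. It is nonzero because the value of a
  -- function at `g` is the value at `1` of its translate by `g`.
  refine ⟨d, ρ, LinearMap.proj 1 ∘ₗ (Representation.coindV ι σ).subtype ∘ₗ i, hρ, fun h0 => ?_,
    fun h v => ?_⟩
  · obtain ⟨v, hv⟩ := exists_ne (0 : Fin d → ℂ)
    refine hv (hi ((Subtype.ext (funext fun g => ?_)).trans (map_zero i).symm))
    have := LinearMap.congr_fun h0 (ρ g v)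
    change (i (ρ g v)).1 1 = 0 at this
    rw [hiρ] at this
    change (i v).1 (1 * g) = 0 at this
    rwa [one_mul] at this
  · change (i (ρ (ι h) v)).1 1 = σ h ((i v).1 1)
    rw [hiρ]
    change (i v).1 (1 * ι h) = _
    rw [one_mul, ← (i v).2 h 1, mul_one]

/-- The sum of the conjugates of an operator acts on an irreducible representation by a scalar. -/
lemma exists_sum_trace_conj_eq [Fintype G] {V : Type*} [AddCommGroup V] [Module ℂ V]
    [FiniteDimensional ℂ V] (ρ : Representation ℂ G V) (hρ : ρ.IsIrreducible) (E : V →ₗ[ℂ] V) :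
    ∃ c : ℂ, ∀ g, ∑ k : G, LinearMap.trace ℂ V (ρ (k * g * k⁻¹) * E) = c * ρ.character g := by
  have hV := (isIrreducible_iff_forall_submodule ρ).1 hρ
  -- `Z` commutes with `G`, so an eigenspace of it is invariant and `Z` is a scalar (Schur).
  let Z : V →ₗ[ℂ] V := ∑ k : G, ρ k⁻¹ * E * ρ k
  have hZ : ∀ g, ρ g * Z = Z * ρ g := by
    intro g
    rw [Finset.mul_sum, Finset.sum_mul]
    refine Fintype.sum_equiv (Equiv.mulRight g⁻¹) _ _ fun k => ?_
    rw [← mul_assoc, ← mul_assoc, ← map_mul, mul_assoc _ _ (ρ g), ← map_mul]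
    simp
  have := hV.1
  obtain ⟨c, hc⟩ := Module.End.exists_eigenvalue Z
  have htop : Module.End.eigenspace Z c = ⊤ := by
    refine (hV.2 _ fun g v hv => ?_).resolve_left hc
    rw [Module.End.mem_eigenspace_iff] at hv ⊢
    rw [← Module.End.mul_apply, ← hZ, Module.End.mul_apply, hv, map_smul]
  have hZc : Z = c • 1 := LinearMap.ext fun v =>
    Module.End.mem_eigenspace_iff.1 (htop ▸ Submodule.mem_top)
  refine ⟨c, fun g => ?_⟩
  have hsum : ∀ k : G, LinearMap.trace ℂ V (ρ (k * g * k⁻¹) * E) =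
      LinearMap.trace ℂ V (ρ g * (ρ k⁻¹ * E * ρ k)) := fun k => by
    rw [map_mul ρ, map_mul ρ, mul_assoc, mul_assoc, LinearMap.trace_mul_comm]
    simp only [mul_assoc]
  rw [Finset.sum_congr rfl fun k _ => hsum k, ← map_sum, ← Finset.mul_sum]
  change LinearMap.trace ℂ V (ρ g * Z) = _
  rw [hZc, mul_smul_comm, mul_one, map_smul]
  rfl

/-- The Clifford correspondence for a linear character `τ` of a normal subgroup `N` of `H` that
satisfies the Mackey condition outside `H`. -/
theorem isIrrChar_iff_of_mackey [Fintype G] [Finite H] [N.Normal] (hι : Function.Injective ι)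
    (hτ : ∀ (h : H) (x : N), τ (MulAut.conjNormal h x) = τ x)
    (hM : ∀ g ∉ Set.range ι, ∃ x y : N, g * ι x = ι y * g ∧ τ x ≠ τ y)
    (Φ : G → ℂ) (φ : H → ℂ)
    (hφ : ∀ h, (Nat.card N : ℂ)⁻¹ * ∑ x : N, τ x⁻¹ * Φ (ι (h * x)) = φ h)
    (hφ1 : φ 1 ≠ 0) (hφN : ∀ x : N, φ x = τ x * φ 1)
    (hΦ : ∀ g, ∑ k : G, Function.extend ι φ 0 (k * g * k⁻¹) = Nat.card H * Φ g) :
    IsIrrChar Φ ↔ IsIrrChar φ := by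
  constructor
  · rintro ⟨d, ρ, hρ, rfl⟩
    have htr : ∀ h, LinearMap.trace ℂ _ (ρ (ι h) * charProj τ (ρ.comp ι)) = φ h := fun h =>
      (trace_mul_charProj τ (ρ.comp ι) h).trans (hφ h)
    have hE : charProj τ (ρ.comp ι) ≠ 0 := by
      intro h0
      apply hφ1
      rw [← htr, h0, mul_zero, map_zero]
    convert! isIrrChar_character _ (isIrreducible_charRange ρ hτ hM hρ hE) using 1
    funext h
    rw [character_charRange]
    exact (htr h).symm
  · rintro ⟨d', σ, hσ, rfl⟩
    obtain ⟨d, ρ, f, hρ, hf, hfσ⟩ := exists_irreducible_intertwining hι σ hσ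
    -- `N` acts on the target through `τ`, so `f` factors through `E`; restricted to the range of
    -- `E` it is a nonzero map of irreducible representations of `H`, hence an isomorphism.
    have hfE : ∀ v, f (charProj τ (ρ.comp ι) v) = f v := by
      intro v
      have h1 : f (charProj τ (ρ.comp ι) v) = charProj τ σ (f v) := by
        simp [charProj, LinearMap.sum_apply, hfσ]
      rw [h1, charProj_eq_one hτ σ hσ hφN]
      rfl
    have hE : charProj τ (ρ.comp ι) ≠ 0 := by
      intro h0
      refine hf (LinearMap.ext fun v => ?_)
      rw [← hfE, h0]
      simp
    have hU := isIrreducible_charRange ρ hτ hM hρ hE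
    let F : Representation.IntertwiningMap (charRange (ρ.comp ι) hτ).toRepresentation σ :=
      { toLinearMap := f ∘ₗ (charRange (ρ.comp ι) hτ).toSubmodule.subtype
        isIntertwining' := fun h => LinearMap.ext fun v => hfσ h v }
    have hF : Function.Bijective F := by
      refine (Representation.IsIrreducible.bijective_or_eq_zero F).resolve_right fun h0 => ?_
      refine hf (LinearMap.ext fun v => ?_)
      rw [← hfE]
      exact congrArg (fun F : Representation.IntertwiningMap _ _ =>
        F ⟨charProj τ (ρ.comp ι) v, v, rfl⟩) h0
    have hχ : ∀ h, LinearMap.trace ℂ _ (ρ (ι h) * charProj τ (ρ.comp ι)) = σ.character h := by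
      intro h
      rw [← Representation.char_iso (F.ofBijective hF), character_charRange]
      rfl
    obtain ⟨c, hc⟩ := exists_sum_trace_conj_eq ρ hρ (charProj τ (ρ.comp ι))
    have hext : ∀ g, LinearMap.trace ℂ _ (ρ g * charProj τ (ρ.comp ι)) =
        Function.extend ι σ.character 0 g := by
      intro g
      by_cases hg : g ∈ Set.range ι
      · obtain ⟨h, rfl⟩ := hg
        rw [hι.extend_apply, hχ]
      · rw [Function.extend_apply' _ _ _ hg, trace_mul_charProj_eq_zero ρ (hM g hg)]
        rfl
    simp only [hext, hΦ] at hc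
    -- By `hc`, `|H| Φ = c χ` with `χ` the character of `ρ`. Averaged against `τ` at the identity,
    -- `Φ` and `χ` both give the nonzero number `σ.character 1`, which identifies `c`.
    have hcH : (Nat.card H : ℂ) = c := by
      refine mul_right_cancel₀ hφ1 ?_
      have h2 : (Nat.card N : ℂ)⁻¹ * ∑ x : N, τ x⁻¹ * ρ.character (ι (1 * x)) =
        σ.character 1 := (trace_mul_charProj τ (ρ.comp ι) 1).symm.trans (hχ 1)
      nth_rewrite 1 [← hφ 1]
      rw [← h2, mul_left_comm, mul_left_comm c]
      congr 1
      rw [Finset.mul_sum, Finset.mul_sum]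
      refine Finset.sum_congr rfl fun x _ => ?_
      rw [mul_left_comm, hc, mul_left_comm]
    have hH : (Nat.card H : ℂ) ≠ 0 := Nat.cast_ne_zero.2 Nat.card_pos.ne'
    have : Φ = ρ.character := by
      funext g
      have := hc g
      rw [← hcH] at this
      exact mul_left_cancel₀ hH this
    exact ⟨d, ρ, hρ, this.symm⟩

end Correspondence

/-! ### Calculus in algebra groups, conjugation and functoriality -/

section Tail

variable {K n m : Type*} [Field K] [NonUnitalRing n] [Module K n]
  [IsScalarTower K n n] [SMulCommClass K n n] [NonUnitalRing m] [Module K m]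
  [IsScalarTower K m m] [SMulCommClass K m m]

/-- The element `X` of `n` with `g = 1 + X`. -/
def tail (g : AlgebraGroup K n) : n := (g : (Unitization K n)ˣ).val.snd

lemma val_eq_one_add_tail (g : AlgebraGroup K n) :
    (g : (Unitization K n)ˣ).val = 1 + ((tail g : n) : Unitization K n) := by
  have hg : (g : (Unitization K n)ˣ).val.fst = 1 := by
    have := congrArg Units.val (MonoidHom.mem_ker.1 g.2)
    simpa using this
  ext
  · simp [hg]
  · simp [tail]

lemma tail_injective : Function.Injective (tail : AlgebraGroup K n → n) := fun g h e =>
  Subtype.ext (Units.ext (by rw [val_eq_one_add_tail, val_eq_one_add_tail, e]))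

lemma tail_eq_of_val {g : AlgebraGroup K n} {X : n}
    (h : (g : (Unitization K n)ˣ).val = 1 + (X : Unitization K n)) : tail g = X := by
  simp [tail, h]

@[simp]
lemma tail_one : tail (1 : AlgebraGroup K n) = 0 := by simp [tail]

lemma tail_mul (g h : AlgebraGroup K n) : tail (g * h) = tail g + tail h + tail g * tail h := by
  refine tail_eq_of_val ?_
  change (g : (Unitization K n)ˣ).val * (h : (Unitization K n)ˣ).val = _
  simp only [val_eq_one_add_tail, Unitization.inr_add, Unitization.inr_mul]
  noncomm_ring

lemma tail_add_tail_inv (g : AlgebraGroup K n) :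
    tail g + tail g⁻¹ + tail g * tail g⁻¹ = 0 := by
  rw [← tail_mul, mul_inv_cancel, tail_one]

lemma tail_inv_add_tail (g : AlgebraGroup K n) :
    tail g⁻¹ + tail g + tail g⁻¹ * tail g = 0 := by
  rw [← tail_mul, inv_mul_cancel, tail_one]

lemma conjMap_apply (g : AlgebraGroup K n) (X : n) :
    conjMap g X = X + tail g * X + X * tail g⁻¹ + tail g * X * tail g⁻¹ := by
  refine Unitization.inr_injective (R := K) ?_
  have hi : (g : (Unitization K n)ˣ)⁻¹.val = 1 + ((tail g⁻¹ : n) : Unitization K n) :=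
    val_eq_one_add_tail g⁻¹
  rw [inr_conjMap, hi, val_eq_one_add_tail]
  simp only [Unitization.inr_add, Unitization.inr_mul]
  noncomm_ring

lemma tail_conj (g h : AlgebraGroup K n) : tail (g * h * g⁻¹) = conjMap g (tail h) := by
  refine tail_eq_of_val ?_
  rw [inr_conjMap]
  change (g : (Unitization K n)ˣ).val * (h : (Unitization K n)ˣ).val *
    (g : (Unitization K n)ˣ)⁻¹.val = _
  rw [val_eq_one_add_tail h, mul_add, add_mul, mul_one, Units.mul_inv]

lemma conjMap_mul (g h : AlgebraGroup K n) (X : n) :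
    conjMap (g * h) X = conjMap g (conjMap h X) := by
  refine Unitization.inr_injective (R := K) ?_
  simp only [inr_conjMap]
  change (g : (Unitization K n)ˣ).val * (h : (Unitization K n)ˣ).val * _ *
    ((g : (Unitization K n)ˣ) * (h : (Unitization K n)ˣ))⁻¹.val = _
  rw [mul_inv_rev, Units.val_mul]
  simp only [mul_assoc]

lemma conjMap_one (X : n) : conjMap (1 : AlgebraGroup K n) X = X := by
  simp [conjMap_apply]

lemma conjMap_inv_apply (g : AlgebraGroup K n) (X : n) : conjMap g⁻¹ (conjMap g X) = X := by
  rw [← conjMap_mul, inv_mul_cancel, conjMap_one]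

lemma conjMap_apply_inv (g : AlgebraGroup K n) (X : n) : conjMap g (conjMap g⁻¹ X) = X := by
  rw [← conjMap_mul, mul_inv_cancel, conjMap_one]

/-- This is `g (X g) g⁻¹ = g X`, which removes the inverse from later computations. -/
lemma conjMap_add_mul_tail (g : AlgebraGroup K n) (X : n) :
    conjMap g (X + X * tail g) = X + tail g * X := by
  have h := tail_add_tail_inv g
  rw [conjMap_apply]
  have e : X + X * tail g + tail g * (X + X * tail g) + (X + X * tail g) * tail g⁻¹ +
      tail g * (X + X * tail g) * tail g⁻¹ = X + tail g * X +
      X * (tail g + tail g⁻¹ + tail g * tail g⁻¹) +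
      tail g * X * (tail g + tail g⁻¹ + tail g * tail g⁻¹) := by noncomm_ring
  rw [e, h, mul_zero, mul_zero, add_zero, add_zero]

lemma units_conj_aeval {A : Type*} [Ring A] [Algebra K A] (u : Aˣ) (a : A) (p : Polynomial K) :
    (u : A) * Polynomial.aeval a p * (u⁻¹ : Aˣ) = Polynomial.aeval (u * a * (u⁻¹ : Aˣ)) p := by
  simp only [Polynomial.aeval_eq_sum_range, Finset.mul_sum, Finset.sum_mul, Units.conj_pow,
    mul_smul_comm, smul_mul_assoc]

/-- The homomorphism of algebra groups induced by a homomorphism of algebras. -/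
def mapGroup (j : m →ₙₐ[K] n) : AlgebraGroup K m →* AlgebraGroup K n :=
  ((Units.map (Unitization.lift ((Unitization.inrNonUnitalAlgHom K n).comp j) :
      Unitization K m →* Unitization K n)).comp
    (Subgroup.subtype _)).codRestrict _ fun g => by
      rw [MonoidHom.mem_ker]
      ext
      simp [val_eq_one_add_tail]

lemma mapGroup_val (j : m →ₙₐ[K] n) (h : AlgebraGroup K m) :
    ((mapGroup j h : AlgebraGroup K n) : (Unitization K n)ˣ).val =
      Unitization.lift ((Unitization.inrNonUnitalAlgHom K n).comp j)
        (h : (Unitization K m)ˣ).val := rfl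

lemma tail_mapGroup (j : m →ₙₐ[K] n) (h : AlgebraGroup K m) :
    tail (mapGroup j h) = j (tail h) := by
  refine tail_eq_of_val ?_
  rw [mapGroup_val, val_eq_one_add_tail]
  simp

lemma mapGroup_injective {j : m →ₙₐ[K] n} (hj : Function.Injective j) :
    Function.Injective (mapGroup j) := fun g h e =>
  tail_injective (hj (by rw [← tail_mapGroup, ← tail_mapGroup, e]))

lemma map_conjMap (j : m →ₙₐ[K] n) (h : AlgebraGroup K m) (x : m) :
    j (conjMap h x) = conjMap (mapGroup j h) (j x) := by
  simp only [conjMap_apply, map_add, map_mul, ← map_inv, tail_mapGroup]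

variable [IsNilpotentAlgebra K n]

@[simp]
lemma tail_oneAdd (X : n) : tail (oneAdd K n X) = X := by simp [tail, oneAdd]

lemma mem_range_mapGroup {j : n →ₙₐ[K] m} {g : AlgebraGroup K m} :
    g ∈ Set.range (mapGroup j) ↔ tail g ∈ Set.range j := by
  constructor
  · rintro ⟨h, rfl⟩
    exact ⟨tail h, (tail_mapGroup j h).symm⟩
  · rintro ⟨x, hx⟩
    exact ⟨oneAdd K n x, tail_injective (by rw [tail_mapGroup, tail_oneAdd, hx])⟩

variable [IsNilpotentAlgebra K m] (p : Polynomial K) (h0 : p.coeff 0 = 1)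
include h0

lemma mapGroup_polyMap (j : m →ₙₐ[K] n) (x : m) :
    mapGroup j (polyMap p x) = polyMap p (j x) := by
  refine Subtype.ext (Units.ext ?_)
  rw [mapGroup_val, polyMap_val p h0, polyMap_val p h0, ← Polynomial.aeval_algHom_apply]
  congr 1
  simp

/-- Polynomial evaluation commutes with conjugation by a unit; this lets the induction formula be
checked before twisting. -/
lemma conj_polyMap (g : AlgebraGroup K n) (X : n) :
    g * polyMap p X * g⁻¹ = polyMap p (conjMap g X) := by
  refine Subtype.ext (Units.ext ?_)
  rw [polyMap_val p h0, inr_conjMap]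
  change (g : (Unitization K n)ˣ).val * (polyMap p X : (Unitization K n)ˣ).val *
    (g : (Unitization K n)ˣ)⁻¹.val = _
  rw [polyMap_val p h0, units_conj_aeval]

lemma polyMap_zero : polyMap p (0 : n) = 1 := by
  refine Subtype.ext (Units.ext ?_)
  rw [polyMap_val p h0, Unitization.inr_zero, ← Polynomial.coeff_zero_eq_aeval_zero', h0]
  simp

end Tail

/-! ### The commutator form and its radical -/

section Radical

variable {K n m : Type*} [Field K] [NonUnitalRing n] [Module K n]
  [IsScalarTower K n n] [SMulCommClass K n n] [NonUnitalRing m] [Module K m]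
  [IsScalarTower K m m] [SMulCommClass K m m]

/-- The alternating form `(X, Y) ↦ lam (X Y - Y X)`. -/
def commForm (lam : Module.Dual K n) : LinearMap.BilinForm K n :=
  LinearMap.mk₂ K (fun X Y => lam (X * Y - Y * X))
    (fun a b c => by rw [← map_add]; congr 1; noncomm_ring)
    (fun c a b => by rw [smul_mul_assoc, mul_smul_comm, ← smul_sub, map_smul])
    (fun a b c => by rw [← map_add]; congr 1; noncomm_ring)
    (fun c a b => by rw [smul_mul_assoc, mul_smul_comm, ← smul_sub, map_smul])

lemma commForm_apply (lam : Module.Dual K n) (X Y : n) :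
    commForm lam X Y = lam (X * Y - Y * X) := rfl

lemma commForm_isRefl (lam : Module.Dual K n) : (commForm lam).IsRefl := fun X Y h => by
  rw [commForm_apply] at h ⊢
  rw [← neg_sub, map_neg, h, neg_zero]

/-- The radical of the form `commForm lam`. -/
def radical (lam : Module.Dual K n) : Submodule K n := (commForm lam).orthogonal ⊤

lemma mem_radical {lam : Module.Dual K n} {X : n} :
    X ∈ radical lam ↔ ∀ Z, lam (X * Z) = lam (Z * X) := by
  rw [radical, LinearMap.BilinForm.mem_orthogonal_iff]
  refine ⟨fun h Z => ?_, fun h Z _ => ?_⟩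
  · have := h Z Submodule.mem_top
    rw [commForm_apply, map_sub, sub_eq_zero] at this
    exact this.symm
  · rw [commForm_apply, map_sub, sub_eq_zero]
    exact (h Z).symm

/-- The left kernel of the form `(X, Y) ↦ lam (X Y)`. -/
def leftKernel (lam : Module.Dual K n) : Submodule K n where
  carrier := {Y | ∀ Z, lam (Y * Z) = 0}
  add_mem' := fun ha hb Z => by rw [add_mul, map_add, ha Z, hb Z, add_zero]
  zero_mem' := fun Z => by rw [zero_mul, map_zero]
  smul_mem' := fun c a ha Z => by rw [smul_mul_assoc, map_smul, ha Z, smul_zero]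

lemma mul_mem_leftKernel {lam : Module.Dual K n} {Y : n} (hY : Y ∈ leftKernel lam) (Z : n) :
    Y * Z ∈ leftKernel lam := fun W => by rw [mul_assoc]; exact hY _

/-- The subspace of all `X` with `lam (X Y) = 0` for `Y` in the left kernel `l` of `lam` contains
its own orthogonal space with respect to `commForm lam`, because this is `l + radical lam`. -/
lemma card_mul_card_radical [Finite K] [FiniteDimensional K n] {j : m →ₙₐ[K] n}
    (hj : Function.Injective j) {lam : Module.Dual K n} {mu : Module.Dual K m}
    (hmu : ∀ x, mu x = lam (j x))
    (hr : ∀ X, X ∈ Set.range j ↔ ∀ Y ∈ leftKernel lam, lam (X * Y) = 0) :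
    Nat.card n * Nat.card (radical lam) = Nat.card m * Nat.card (radical mu) := by
  have : Finite n := Module.finite_of_finite K
  let jl : m →ₗ[K] n := j
  set s : Submodule K n := LinearMap.range jl with hs
  have hms : ∀ X, X ∈ s ↔ ∀ Y ∈ leftKernel lam, lam (X * Y) = 0 := hr
  set B := commForm lam with hB
  have hsl : B.orthogonal (leftKernel lam) = s := by
    ext X
    rw [LinearMap.BilinForm.mem_orthogonal_iff, hms]
    refine forall₂_congr fun Y hY => ?_
    rw [hB, commForm_apply, map_sub, hY X, zero_sub,
      neg_eq_zero]
  have hrad : radical lam ≤ s := fun X hX => (hms X).2 fun Y hY => by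
    rw [mem_radical.1 hX, hY]
  have hls : leftKernel lam ≤ s := fun X hX => (hms X).2 fun Y hY => hX Y
  have hle : leftKernel lam ⊔ radical lam ≤ B.orthogonal s := by
    refine sup_le (fun X hX => ?_) (LinearMap.BilinForm.orthogonal_le le_top)
    rw [LinearMap.BilinForm.mem_orthogonal_iff]
    intro Y hY
    rw [hB, commForm_apply, map_sub, hX Y, (hms Y).1 hY X hX,
      sub_zero]
  -- With `r` the radical, `d1` reads `dim l + dim s = dim n + dim (l ∩ r)` and `d2` reads `dim s +
  -- dim s^⊥ = dim n + dim r`. Hence `dim s^⊥ = dim (l + r)`, and the inclusion `hle` is an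
  -- equality.
  have d1 := LinearMap.BilinForm.finrank_add_finrank_orthogonal (commForm_isRefl lam)
    (leftKernel lam)
  have d2 := LinearMap.BilinForm.finrank_add_finrank_orthogonal (commForm_isRefl lam) s
  have d3 := Submodule.finrank_sup_add_finrank_inf_eq (leftKernel lam) (radical lam)
  rw [← hB] at d1 d2
  rw [hsl] at d1
  change _ = _ + Module.finrank K ↥(leftKernel lam ⊓ radical lam) at d1
  change _ = _ + Module.finrank K ↥(s ⊓ radical lam) at d2
  rw [inf_eq_right.2 hrad] at d2
  have heq : leftKernel lam ⊔ radical lam = B.orthogonal s :=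
    Submodule.eq_of_le_of_finrank_eq hle (by omega)
  have hos : B.orthogonal s ≤ s := heq ▸ sup_le hls hrad
  -- Because `s^⊥ ⊆ s`, it is exactly the radical of the form restricted to `s`; then `d2` is the
  -- identity of exponents wanted.
  have hmap : (radical mu).map jl = B.orthogonal s := by
    ext X
    rw [LinearMap.BilinForm.mem_orthogonal_iff]
    constructor
    · rintro ⟨x, hx, rfl⟩ _ ⟨y, rfl⟩
      rw [hB, commForm_apply, map_sub, sub_eq_zero]
      change lam (j y * j x) = lam (j x * j y)
      rw [← map_mul, ← map_mul, ← hmu, ← hmu]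
      exact (mem_radical.1 hx y).symm
    · intro hX
      obtain ⟨x, rfl⟩ := hos hX
      refine ⟨x, mem_radical.2 fun z => ?_, rfl⟩
      have := hX (j z) ⟨z, rfl⟩
      rw [hB, commForm_apply, map_sub, sub_eq_zero] at this
      rw [hmu, hmu, map_mul j, map_mul j]
      exact this.symm
  have hjl : Function.Injective jl := hj
  have c1 : Nat.card m = Nat.card s :=
    Nat.card_congr (LinearEquiv.ofInjective jl hjl).toEquiv
  have c2 : Nat.card (radical mu) = Nat.card (B.orthogonal s) := by
    rw [← hmap]
    exact Nat.card_congr (Submodule.equivMapOfInjective jl hjl _).toEquiv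
  rw [c1, c2, Module.natCard_eq_pow_finrank (K := K) (V := n),
    Module.natCard_eq_pow_finrank (K := K) (V := s),
    Module.natCard_eq_pow_finrank (K := K) (V := radical lam),
    Module.natCard_eq_pow_finrank (K := K) (V := B.orthogonal s), ← pow_add, ← pow_add, d2]

end Radical

/-! ### Kirillov functions as sums over the group -/

section KirillovSum

variable {K n : Type*} [Field K] [NonUnitalRing n] [Module K n]
  [IsScalarTower K n n] [SMulCommClass K n n]

/-- After substituting `X g` for `X`, invariance of `lam` reads `lam (g X) = lam (X g)`. -/
lemma comp_conjMap_eq_self_iff (lam : Module.Dual K n) (g : AlgebraGroup K n) :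
    lam ∘ₗ conjMap g = lam ↔ tail g ∈ radical lam := by
  rw [mem_radical]
  constructor
  · intro h Z
    have := LinearMap.congr_fun h (Z + Z * tail g)
    rw [LinearMap.comp_apply, conjMap_add_mul_tail, map_add, map_add] at this
    exact add_left_cancel this
  · intro h
    ext X
    have e : X = (X + X * tail g⁻¹) + (X + X * tail g⁻¹) * tail g := by
      have : (X + X * tail g⁻¹) + (X + X * tail g⁻¹) * tail g =
        X + X * (tail g⁻¹ + tail g + tail g⁻¹ * tail g) := by noncomm_ring
      rw [this, tail_inv_add_tail, mul_zero, add_zero]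
    rw [LinearMap.comp_apply]
    nth_rewrite 1 [e]
    rw [conjMap_add_mul_tail, map_add, h, ← map_add, ← e]

variable [IsNilpotentAlgebra K n]

instance algebraGroup_finite [Finite n] : Finite (AlgebraGroup K n) :=
  Finite.of_equiv n (oneAdd K n)

/-- Right multiplication by `g₀⁻¹` carries the fibre onto the stabiliser of `lam`, which is `1 +
radical lam`. -/
lemma card_fiber_conjMap (lam : Module.Dual K n) (g₀ : AlgebraGroup K n) :
    Nat.card {g : AlgebraGroup K n // lam ∘ₗ conjMap g = lam ∘ₗ conjMap g₀} =
      Nat.card (radical lam) := by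
  refine Nat.card_congr (((Equiv.mulRight g₀⁻¹).trans (oneAdd K n).symm).subtypeEquiv
    fun g => ?_)
  have key : lam ∘ₗ conjMap g = lam ∘ₗ conjMap g₀ ↔ lam ∘ₗ conjMap (g * g₀⁻¹) = lam := by
    constructor
    · intro h
      ext X
      have := LinearMap.congr_fun h (conjMap g₀⁻¹ X)
      simpa [conjMap_mul, conjMap_apply_inv] using this
    · intro h
      ext X
      have := LinearMap.congr_fun h (conjMap g₀ X)
      simpa [conjMap_mul, conjMap_inv_apply] using this
  rw [key, comp_conjMap_eq_self_iff]
  rfl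

/-- The Kirillov function as a sum over the group. -/
lemma kirillov_oneAdd [Finite n] [Fintype (AlgebraGroup K n)] (θ : AddChar K ℂ)
    (lam : Module.Dual K n) (X : n) :
    kirillov θ lam (oneAdd K n X) =
      ((Real.sqrt (Nat.card n * Nat.card (radical lam) : ℕ) : ℝ) : ℂ)⁻¹ *
        ∑ g : AlgebraGroup K n, θ (lam (conjMap g X)) := by
  classical
  set O : AlgebraGroup K n → Module.Dual K n := fun g => lam ∘ₗ conjMap g with hO
  set r := Nat.card (radical lam) with hr
  have hr0 : r ≠ 0 := Nat.card_pos.ne'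
  have horb : coadjointOrbit lam = ((Finset.univ.image O : Finset _) : Set (Module.Dual K n)) := by
    rw [Finset.coe_image, Finset.coe_univ, Set.image_univ]
    rfl
  have hfib : ∀ ν ∈ Finset.univ.image O, (Finset.univ.filter fun g => O g = ν).card = r := by
    intro ν hν
    obtain ⟨g₀, -, rfl⟩ := Finset.mem_image.1 hν
    rw [hr, ← card_fiber_conjMap lam g₀, Nat.card_eq_fintype_card, Fintype.card_subtype]
  have hsum : ∀ f : Module.Dual K n → ℂ,
      ∑ g, f (O g) = r * ∑ ν ∈ Finset.univ.image O, f ν := by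
    intro f
    rw [Finset.sum_comp f O, Finset.mul_sum]
    refine Finset.sum_congr rfl fun ν hν => ?_
    rw [hfib ν hν, nsmul_eq_mul]
  set N := (coadjointOrbit lam).ncard with hN
  have hNcard : N = (Finset.univ.image O).card := by rw [hN, horb, Set.ncard_coe_finset]
  -- Orbit-stabiliser, as the case `f = 1` of `hsum`. The resulting factor `r` in the square root
  -- cancels the multiplicity of each orbit point in the group sum.
  have hcard : Nat.card n = r * N := by
    have := hsum fun _ => 1
    simp only [Finset.sum_const, nsmul_eq_mul, mul_one, Finset.card_univ] at this
    rw [← hNcard, ← Nat.card_eq_fintype_card, ← Nat.card_congr (oneAdd K n)] at this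
    exact_mod_cast this
  have hsqrt : Real.sqrt (Nat.card n * r : ℕ) = r * Real.sqrt N := by
    rw [hcard, show ((r * N * r : ℕ) : ℝ) = (r : ℝ) ^ 2 * N by push_cast; ring,
      Real.sqrt_mul (by positivity), Real.sqrt_sq (by positivity)]
  have hθ : ∑ g : AlgebraGroup K n, θ (lam (conjMap g X)) = _ := hsum fun ν => θ (ν X)
  rw [kirillov, ← hN, hsqrt, horb, finsum_mem_coe_finset, hθ]
  have ht : ∀ ν : Module.Dual K n, thetaFun θ ν (oneAdd K n X) = θ (ν X) := fun ν => by
    change θ (ν (tail (oneAdd K n X))) = _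
    rw [tail_oneAdd]
  simp only [ht]
  have hr0' : (r : ℂ) ≠ 0 := Nat.cast_ne_zero.2 hr0
  push_cast
  rw [mul_inv, mul_assoc, mul_left_comm, ← mul_assoc (r : ℂ)⁻¹, inv_mul_cancel₀ hr0', one_mul]

end KirillovSum

/-! ### Orthogonality of additive characters -/

section CharacterSums

variable {K M : Type*} [Field K] [AddCommGroup M] [Module K M]

lemma exists_addChar_mul_ne_one {θ : AddChar K ℂ} (hθ : θ ≠ 1) {a : K} (ha : a ≠ 0) :
    ∃ c : K, θ (c * a) ≠ 1 := by
  obtain ⟨b, hb⟩ := AddChar.ne_one_iff.1 hθ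
  exact ⟨b * a⁻¹, by rwa [inv_mul_cancel_right₀ ha]⟩

lemma sum_addChar_linear_eq_zero [Fintype M] {θ : AddChar K ℂ} (hθ : θ ≠ 1) {f : M →ₗ[K] K}
    (hf : f ≠ 0) : ∑ w : M, θ (f w) = 0 := by
  obtain ⟨w, hw⟩ : ∃ w, f w ≠ 0 := by
    by_contra! h
    exact hf (LinearMap.ext h)
  obtain ⟨c, hc⟩ := exists_addChar_mul_ne_one hθ hw
  have hne : θ.compAddMonoidHom f.toAddMonoidHom ≠ 0 :=
    AddChar.ne_one_iff.2 ⟨c • w, by simpa using hc⟩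
  exact AddChar.sum_eq_zero_iff_ne_zero.2 hne

end CharacterSums

/-! ### The normal subgroup `1 + I` and its linear character -/

section Ideal

variable {K m : Type*} [Field K] [NonUnitalRing m] [Module K m]
  [IsScalarTower K m m] [SMulCommClass K m m]

/-- A two-sided ideal `I` such that `mu` vanishes on the products of elements of `I` with elements
of the algebra. -/
structure IsNullIdeal (mu : Module.Dual K m) (I : Submodule K m) : Prop where
  mul_mem_right : ∀ w ∈ I, ∀ z, w * z ∈ I
  mul_mem_left : ∀ w ∈ I, ∀ z, z * w ∈ I
  map_mul_right : ∀ w ∈ I, ∀ z, mu (w * z) = 0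
  map_mul_left : ∀ w ∈ I, ∀ z, mu (z * w) = 0

namespace IsNullIdeal

variable {mu : Module.Dual K m} {I : Submodule K m} (hI : IsNullIdeal mu I)
include hI

lemma conjMap_mem (h : AlgebraGroup K m) {w : m} (hw : w ∈ I) : conjMap h w ∈ I := by
  rw [conjMap_apply]
  exact add_mem (add_mem (add_mem hw (hI.mul_mem_left w hw _)) (hI.mul_mem_right w hw _))
    (hI.mul_mem_right _ (hI.mul_mem_left w hw _) _)

lemma map_conjMap_eq (h : AlgebraGroup K m) {w : m} (hw : w ∈ I) : mu (conjMap h w) = mu w := by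
  rw [conjMap_apply, map_add, map_add, map_add, hI.map_mul_left w hw, hI.map_mul_right w hw,
    hI.map_mul_right _ (hI.mul_mem_left w hw _), add_zero, add_zero, add_zero]

/-- Every word in the difference has length at least two and contains `w`, so it lies in `I` and
`mu` kills it. Hence only the linear coefficient of `F` is visible to `mu`. -/
lemma inr_pow_sub_pow (x : m) {w : m} (hw : w ∈ I) (k : ℕ) :
    ∃ z ∈ I, mu z = 0 ∧ ((x + w : m) : Unitization K m) ^ (k + 2) -
      (x : Unitization K m) ^ (k + 2) = (z : Unitization K m) := by
  induction k with
  | zero =>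
    refine ⟨x * w + w * x + w * w, ?_, ?_, ?_⟩
    · exact add_mem (add_mem (hI.mul_mem_left w hw _) (hI.mul_mem_right w hw _))
        (hI.mul_mem_right w hw _)
    · rw [map_add, map_add, hI.map_mul_left w hw, hI.map_mul_right w hw, hI.map_mul_right w hw,
        add_zero, add_zero]
    · simp only [Unitization.inr_add, Unitization.inr_mul]
      noncomm_ring
  | succ k ih =>
    obtain ⟨z, hz, -, e⟩ := ih
    obtain ⟨v, -, e'⟩ := inr_pow_mem (K := K) x (k + 1)
    refine ⟨(x + w) * z + w * v,
      add_mem (hI.mul_mem_left z hz _) (hI.mul_mem_right w hw _), ?_, ?_⟩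
    · rw [map_add, hI.map_mul_left z hz, hI.map_mul_right w hw, add_zero]
    · rw [Unitization.inr_add _ (_ * _), Unitization.inr_mul, Unitization.inr_mul, ← e, ← e',
        Unitization.inr_add, pow_succ' _ (k + 2), pow_succ' _ (k + 2)]
      noncomm_ring

lemma aeval_add_sub_aeval (x : m) {w : m} (hw : w ∈ I) (p : Polynomial K) :
    ∃ z ∈ I, mu z = 0 ∧ Polynomial.aeval ((x + w : m) : Unitization K m) p -
      Polynomial.aeval (x : Unitization K m) p =
        ((p.coeff 1 • w + z : m) : Unitization K m) := by
  induction p using Polynomial.induction_on' with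
  | add a b ha hb =>
    obtain ⟨y, hy, hy0, ey⟩ := ha
    obtain ⟨z, hz, hz0, ez⟩ := hb
    refine ⟨y + z, add_mem hy hz, by rw [map_add, hy0, hz0, add_zero], ?_⟩
    rw [map_add, map_add, add_sub_add_comm, ey, ez, ← Unitization.inr_add, Polynomial.coeff_add,
      add_smul]
    congr 1
    abel
  | monomial k a =>
    match k with
    | 0 => exact ⟨0, zero_mem _, map_zero _, by simp⟩
    | 1 =>
      refine ⟨0, zero_mem _, map_zero _, ?_⟩
      simp [Polynomial.aeval_monomial, ← Algebra.smul_def, smul_add]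
    | k + 2 =>
      obtain ⟨z, hz, hz0, ez⟩ := hI.inr_pow_sub_pow x hw k
      refine ⟨a • z, Submodule.smul_mem _ _ hz, by rw [map_smul, hz0, smul_zero], ?_⟩
      rw [Polynomial.aeval_monomial, Polynomial.aeval_monomial, ← Algebra.smul_def,
        ← Algebra.smul_def, ← smul_sub, ez, Polynomial.coeff_monomial]
      simp

variable [IsNilpotentAlgebra K m] (p : Polynomial K) (h0 : p.coeff 0 = 1) (h1 : p.coeff 1 = 1)
include h0 h1

/-- `F(x + w) = F(x) + w + z` with `mu z = 0`, and multiplying `w + z` by `F(x)⁻¹` adds only a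
product with an element of `I`, which `mu` kills. -/
lemma tail_polyMap_inv_mul (x : m) {w : m} (hw : w ∈ I) :
    tail ((polyMap p x)⁻¹ * polyMap p (x + w)) ∈ I ∧
      mu (tail ((polyMap p x)⁻¹ * polyMap p (x + w))) = mu w := by
  obtain ⟨z, hz, hz0, ez⟩ := hI.aeval_add_sub_aeval x hw p
  rw [h1, one_smul] at ez
  have hwz : w + z ∈ I := add_mem hw hz
  have ht : tail ((polyMap p x)⁻¹ * polyMap p (x + w)) =
      (w + z) + tail (polyMap p x)⁻¹ * (w + z) := by
    refine tail_eq_of_val ?_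
    change (polyMap p x : (Unitization K m)ˣ)⁻¹.val * (polyMap p (x + w) : (Unitization K m)ˣ).val
      = _
    have hi : (polyMap p x : (Unitization K m)ˣ)⁻¹.val =
      1 + ((tail (polyMap p x)⁻¹ : m) : Unitization K m) := val_eq_one_add_tail (polyMap p x)⁻¹
    have e1 : (polyMap p (x + w) : (Unitization K m)ˣ).val =
        (polyMap p x : (Unitization K m)ˣ).val + ((w + z : m) : Unitization K m) := by
      rw [polyMap_val p h0, polyMap_val p h0, ← ez, add_sub_cancel]
    rw [e1, mul_add, Units.inv_mul, hi, add_mul, one_mul, ← Unitization.inr_mul,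
      ← Unitization.inr_add]
  rw [ht]
  refine ⟨add_mem hwz (hI.mul_mem_left _ hwz _), ?_⟩
  rw [map_add, hI.map_mul_left _ hwz, map_add, hz0, add_zero, add_zero]

end IsNullIdeal

/-- The subgroup `1 + I` for a two-sided ideal `I` as in `IsNullIdeal`. -/
def idealSubgroup {mu : Module.Dual K m} {I : Submodule K m} (hI : IsNullIdeal mu I) :
    Subgroup (AlgebraGroup K m) where
  carrier := {h | tail h ∈ I}
  one_mem' := by simp
  mul_mem' := fun {a b} ha hb => by
    change tail (a * b) ∈ I
    rw [tail_mul]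
    exact add_mem (add_mem ha hb) (hI.mul_mem_right _ ha _)
  inv_mem' := fun {a} ha => by
    have e : tail a⁻¹ = -(tail a + tail a * tail a⁻¹) := by
      refine eq_neg_of_add_eq_zero_left ?_
      rw [← tail_add_tail_inv a]
      abel
    change tail a⁻¹ ∈ I
    rw [e]
    exact neg_mem (add_mem ha (hI.mul_mem_right _ ha _))

variable {mu : Module.Dual K m} {I : Submodule K m} (hI : IsNullIdeal mu I)

lemma mem_idealSubgroup {h : AlgebraGroup K m} : h ∈ idealSubgroup hI ↔ tail h ∈ I := Iff.rfl

instance idealSubgroup_normal : (idealSubgroup hI).Normal := ⟨fun h hh g => by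
  rw [mem_idealSubgroup, tail_conj]
  exact hI.conjMap_mem g hh⟩

/-- The linear character `h ↦ θ (mu (h - 1))` of `idealSubgroup hI`. -/
def idealChar (θ : AddChar K ℂ) : idealSubgroup hI →* ℂ where
  toFun h := θ (mu (tail (h : AlgebraGroup K m)))
  map_one' := by simp
  map_mul' a b := by
    rw [Subgroup.coe_mul, tail_mul, map_add mu, map_add mu, hI.map_mul_right _ a.2, add_zero,
      AddChar.map_add_eq_mul]

lemma idealChar_apply (θ : AddChar K ℂ) (h : idealSubgroup hI) :
    idealChar hI θ h = θ (mu (tail (h : AlgebraGroup K m))) := rfl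

lemma idealChar_conjNormal (θ : AddChar K ℂ) (h : AlgebraGroup K m) (x : idealSubgroup hI) :
    idealChar hI θ (MulAut.conjNormal h x) = idealChar hI θ x := by
  rw [idealChar_apply, MulAut.conjNormal_apply, tail_conj, hI.map_conjMap_eq h x.2]
  rfl

variable [IsNilpotentAlgebra K m]

/-- The bijection `w ↦ 1 + w` from `I` to `idealSubgroup hI`. -/
noncomputable def idealEquiv : I ≃ idealSubgroup hI :=
  (oneAdd K m).subtypeEquiv fun w => by
    rw [mem_idealSubgroup, tail_oneAdd]

/-- For fixed `x`, the elements `F(x)⁻¹ F(x + w)` with `w ∈ I` run over the subgroup `1 + I`. -/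
lemma polyMap_inv_mul_bijective [Finite K] [FiniteDimensional K m]
    (p : Polynomial K) (h0 : p.coeff 0 = 1) (h1 : p.coeff 1 = 1) (x : m) :
    Function.Bijective (fun w : I => (⟨(polyMap p x)⁻¹ * polyMap p (x + w),
      (hI.tail_polyMap_inv_mul p h0 h1 x w.2).1⟩ : idealSubgroup hI)) := by
  have : Finite m := Module.finite_of_finite K
  refine Function.Injective.bijective_of_nat_card_le (fun v w h => ?_)
    (Nat.card_congr (idealEquiv hI)).ge
  have := mul_left_cancel (congrArg Subtype.val h)
  exact Subtype.ext (add_left_cancel ((polyMap_bijective p h0 h1).1 this))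

end Ideal

/-! ### One step of the chain -/

section Step

variable {K n m : Type*} [Field K] [NonUnitalRing n] [Module K n]
  [IsScalarTower K n n] [SMulCommClass K n n] [NonUnitalRing m] [Module K m]
  [IsScalarTower K m m] [SMulCommClass K m m]

/-- `j` embeds `m` into `n` as the subalgebra of all `X` with `lam (X Y) = 0` for all `Y` in the
left kernel of `lam`, and `mu` is the restriction of `lam`. -/
structure IsStep (j : m →ₙₐ[K] n) (lam : Module.Dual K n) (mu : Module.Dual K m) : Prop where
  injective : Function.Injective j
  map_apply : ∀ x, mu x = lam (j x)
  mem_range : ∀ X, X ∈ Set.range j ↔ ∀ Y ∈ leftKernel lam, lam (X * Y) = 0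

namespace IsStep

variable {j : m →ₙₐ[K] n} {lam : Module.Dual K n} {mu : Module.Dual K m}

/-- The left kernel of `lam`, as a subspace of `m`. -/
def kernel (_ : IsStep j lam mu) : Submodule K m := (leftKernel lam).comap (j : m →ₗ[K] n)

variable (hs : IsStep j lam mu)
include hs

lemma mem_kernel {w : m} : w ∈ hs.kernel ↔ j w ∈ leftKernel lam := Iff.rfl

lemma isNullIdeal : IsNullIdeal mu hs.kernel where
  mul_mem_right w hw z := by
    rw [mem_kernel, map_mul]
    exact mul_mem_leftKernel hw _
  mul_mem_left w hw z := by
    rw [mem_kernel, map_mul]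
    intro Z
    rw [mul_assoc]
    exact (hs.mem_range _).1 ⟨z, rfl⟩ _ (mul_mem_leftKernel hw _)
  map_mul_right w hw z := by
    rw [hs.map_apply, map_mul j]
    exact hw _
  map_mul_left w hw z := by
    rw [hs.map_apply, map_mul j]
    exact (hs.mem_range _).1 ⟨z, rfl⟩ _ hw

lemma exists_mem_kernel {Y : n} (hY : Y ∈ leftKernel lam) : ∃ w ∈ hs.kernel, j w = Y := by
  obtain ⟨w, rfl⟩ := (hs.mem_range Y).2 fun Z _ => hY Z
  exact ⟨w, hY, rfl⟩

lemma map_conjMap_mapGroup (h : AlgebraGroup K m) (x : m) :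
    lam (conjMap (mapGroup j h) (j x)) = mu (conjMap h x) := by
  rw [hs.map_apply, map_conjMap]

/-- If `X` lies outside the image of `j`, then `lam (X Y) ≠ 0` for some `Y` in the left kernel
such that `X Y` is again in the left kernel. -/
lemma exists_mul_mem_leftKernel [IsNilpotentAlgebra K n] {X : n} (hX : X ∉ Set.range j) :
    ∃ Y ∈ leftKernel lam, X * Y ∈ leftKernel lam ∧ lam (X * Y) ≠ 0 := by
  by_contra! hcon
  obtain ⟨N, hN⟩ := IsNilpotentAlgebra.exists_algPow_eq_bot (K := K) (n := n)
  -- Downward induction on the depth `k` of `Y`: the deeper elements `Y Z` satisfy `lam (X Y Z) =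
  -- 0`, so `X Y` is in the left kernel, and `hcon` gives `lam (X Y) = 0`.
  have key : ∀ i k, k + i = N → ∀ Y ∈ leftKernel lam, Y ∈ algPow K n k → lam (X * Y) = 0 := by
    intro i
    induction i with
    | zero =>
      intro k hk Y _ hY
      rw [add_zero] at hk
      rw [hk, hN, Submodule.mem_bot] at hY
      rw [hY, mul_zero, map_zero]
    | succ i ih =>
      intro k hk Y hY hYk
      refine hcon Y hY fun Z => ?_
      rw [mul_assoc]
      exact ih (k + 1) (by omega) _ (mul_mem_leftKernel hY Z) (algPow_mul_mem hYk Z)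
  exact hX ((hs.mem_range X).2 fun Y hY => key N 0 (zero_add N) Y hY Submodule.mem_top)

/-- With `X = tail g`, choose `Y` in the left kernel with `X Y` there too and, after scaling, `θ
(lam (X Y)) ≠ 1`. The left kernel is a right ideal, so it contains `g Y g⁻¹ = (Y + X Y) g⁻¹`, on
which `lam` equals `lam Y + lam (X Y)`. -/
lemma mackey [IsNilpotentAlgebra K n] [IsNilpotentAlgebra K m] {θ : AddChar K ℂ} (hθ : θ ≠ 1)
    (g : AlgebraGroup K n) (hg : g ∉ Set.range (mapGroup j)) :
    ∃ x y : idealSubgroup hs.isNullIdeal, g * mapGroup j x = mapGroup j y * g ∧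
      idealChar hs.isNullIdeal θ x ≠ idealChar hs.isNullIdeal θ y := by
  rw [mem_range_mapGroup] at hg
  obtain ⟨Y₀, hY₀, hXY₀, hne⟩ := hs.exists_mul_mem_leftKernel hg
  obtain ⟨c, hc⟩ := exists_addChar_mul_ne_one hθ hne
  set Y := c • Y₀
  have hY : Y ∈ leftKernel lam := Submodule.smul_mem _ _ hY₀
  have hXY : tail g * Y ∈ leftKernel lam := by
    rw [mul_smul_comm]
    exact Submodule.smul_mem _ _ hXY₀
  have hθY : θ (lam (tail g * Y)) ≠ 1 := by
    rwa [mul_smul_comm, map_smul, smul_eq_mul]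
  have hconj : conjMap g Y = (Y + tail g * Y) + (Y + tail g * Y) * tail g⁻¹ := by
    rw [conjMap_apply, add_mul, ← add_assoc]
  have hsum : Y + tail g * Y ∈ leftKernel lam := add_mem hY hXY
  have hZ : conjMap g Y ∈ leftKernel lam := by
    rw [hconj]
    exact add_mem hsum (mul_mem_leftKernel hsum _)
  have hlam : lam (conjMap g Y) = lam Y + lam (tail g * Y) := by
    rw [hconj, map_add, hsum, add_zero, map_add]
  obtain ⟨y, hy, hyY⟩ := hs.exists_mem_kernel hY
  obtain ⟨z, hz, hzZ⟩ := hs.exists_mem_kernel hZ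
  refine ⟨idealEquiv hs.isNullIdeal ⟨y, hy⟩, idealEquiv hs.isNullIdeal ⟨z, hz⟩, ?_, ?_⟩
  · refine eq_mul_of_mul_inv_eq (tail_injective ?_)
    rw [tail_conj, tail_mapGroup, tail_mapGroup]
    change conjMap g (j (tail (oneAdd K m y))) = j (tail (oneAdd K m z))
    rw [tail_oneAdd, tail_oneAdd, hyY, hzZ]
  · change θ (mu (tail (oneAdd K m y))) ≠ θ (mu (tail (oneAdd K m z)))
    rw [tail_oneAdd, tail_oneAdd, hs.map_apply, hs.map_apply, hyY, hzZ, hlam,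
      AddChar.map_add_eq_mul]
    intro h
    have h' : θ (lam Y) * 1 = θ (lam Y) * θ (lam (tail g * Y)) := by rw [mul_one, ← h]
    exact hθY (mul_left_cancel₀ (θ.val_isUnit _).ne_zero h').symm

/-- An element of `1 + n` fixes `lam` on the left kernel only if it lies in `1 + m`. -/
lemma mem_range_of_forall_conjMap [IsNilpotentAlgebra K m] {g : AlgebraGroup K n}
    (hg : ∀ w ∈ hs.kernel, lam (conjMap g (j w)) = lam (j w)) : g ∈ Set.range (mapGroup j) := by
  rw [mem_range_mapGroup, hs.mem_range]
  intro Y hY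
  -- Testing on `Y g` rather than `Y` turns the conjugate into `g Y`.
  obtain ⟨w, hw, hwY⟩ := hs.exists_mem_kernel (add_mem hY (mul_mem_leftKernel hY (tail g)))
  have := hg w hw
  rw [hwY, conjMap_add_mul_tail, map_add, map_add, hY, add_zero] at this
  simpa using this

lemma sum_kernel_eq_zero [Fintype hs.kernel] [IsNilpotentAlgebra K m] {θ : AddChar K ℂ}
    (hθ : θ ≠ 1) {g : AlgebraGroup K n} (hg : g ∉ Set.range (mapGroup j)) :
    ∑ w : hs.kernel, θ (lam (conjMap g (j w)) - lam (j w)) = 0 := by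
  let f : hs.kernel →ₗ[K] K :=
    (lam ∘ₗ conjMap g - lam) ∘ₗ (j : m →ₗ[K] n) ∘ₗ hs.kernel.subtype
  refine sum_addChar_linear_eq_zero hθ (f := f) fun h0 =>
    hg (hs.mem_range_of_forall_conjMap fun w hw => ?_)
  exact sub_eq_zero.1 (LinearMap.congr_fun h0 ⟨w, hw⟩)

variable [Fintype (AlgebraGroup K n)] [Fintype (AlgebraGroup K m)]

/-- After exchanging the sums, the inner sum over the kernel vanishes for `g` outside `1 + m` and
counts the kernel for `g` inside. This is the formula for averaging against `τ`. -/
lemma sum_kernel_mul_sum [Fintype hs.kernel] [IsNilpotentAlgebra K m] {θ : AddChar K ℂ}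
    (hθ : θ ≠ 1) (x : m) :
    ∑ w : hs.kernel, θ (-mu w) * ∑ g : AlgebraGroup K n, θ (lam (conjMap g (j (x + w)))) =
      Nat.card hs.kernel * ∑ h : AlgebraGroup K m, θ (mu (conjMap h x)) := by
  have e : ∀ (w : hs.kernel) (g : AlgebraGroup K n),
      θ (-mu w) * θ (lam (conjMap g (j (x + w)))) =
        θ (lam (conjMap g (j x))) * θ (lam (conjMap g (j w)) - lam (j w)) := fun w g => by
    rw [← AddChar.map_add_eq_mul, ← AddChar.map_add_eq_mul, map_add j, map_add (conjMap g),
      map_add lam, hs.map_apply]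
    congr 1
    ring
  simp only [Finset.mul_sum, e]
  rw [Finset.sum_comm]
  simp only [← Finset.mul_sum]
  rw [Finset.mul_sum]
  refine (Fintype.sum_of_injective (mapGroup j) (mapGroup_injective hs.injective) _ _
    (fun g hg => by rw [hs.sum_kernel_eq_zero hθ hg, mul_zero]) fun h => ?_).symm
  have : ∀ w : hs.kernel, θ (lam (conjMap (mapGroup j h) (j w)) - lam (j w)) = 1 := fun w => by
    rw [hs.map_conjMap_mapGroup, hs.isNullIdeal.map_conjMap_eq h w.2, hs.map_apply, sub_self,
      AddChar.map_zero_eq_one]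
  simp only [this, Finset.sum_const, Finset.card_univ, nsmul_eq_mul, mul_one]
  rw [hs.map_conjMap_mapGroup, mul_comm, Nat.card_eq_fintype_card]

lemma conjMap_mem_range_iff (h : AlgebraGroup K m) (Z : n) :
    conjMap (mapGroup j h) Z ∈ Set.range j ↔ Z ∈ Set.range j := by
  constructor
  · rintro ⟨x, hx⟩
    exact ⟨conjMap h⁻¹ x, by rw [map_conjMap, hx, map_inv, conjMap_inv_apply]⟩
  · rintro ⟨x, rfl⟩
    exact ⟨conjMap h x, map_conjMap j h x⟩

lemma extend_conjMap (θ : AddChar K ℂ) (h : AlgebraGroup K m) (x : m) :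
    Function.extend j (fun x => θ (mu x)) 0 (conjMap (mapGroup j h) (j x)) =
      θ (mu (conjMap h x)) := by
  rw [← map_conjMap, hs.injective.extend_apply]

lemma extend_conjMap_eq_zero (θ : AddChar K ℂ) (h : AlgebraGroup K m) {Z : n}
    (hZ : Z ∉ Set.range j) :
    Function.extend j (fun x => θ (mu x)) 0 (conjMap (mapGroup j h) Z) = 0 :=
  Function.extend_apply' _ _ _ ((hs.conjMap_mem_range_iff h Z).not.2 hZ)

/-- Outside the image of `j`, with `y⁻¹ = 1 + w`, one has `lam (y Z y⁻¹) = lam Z + lam (Z w)`, and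
`w ↦ lam (Z w)` is a nonzero functional on the kernel; so averaging over `1 + l` performs the
extension by zero. -/
lemma sum_conjMap_idealSubgroup_eq [IsNilpotentAlgebra K m] {θ : AddChar K ℂ} (hθ : θ ≠ 1)
    [Fintype hs.kernel] [Fintype (idealSubgroup hs.isNullIdeal)] (Z : n) :
    ∑ y : idealSubgroup hs.isNullIdeal, θ (lam (conjMap (mapGroup j y) Z)) =
      ∑ y : idealSubgroup hs.isNullIdeal,
        Function.extend j (fun x => θ (mu x)) 0 (conjMap (mapGroup j y) Z) := by
  by_cases hZ : Z ∈ Set.range j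
  · obtain ⟨x, rfl⟩ := hZ
    refine Finset.sum_congr rfl fun y _ => ?_
    rw [hs.extend_conjMap, hs.map_conjMap_mapGroup]
  · simp only [hs.extend_conjMap_eq_zero θ _ hZ, Finset.sum_const_zero]
    let f : hs.kernel →ₗ[K] K :=
      lam ∘ₗ LinearMap.mulLeft K Z ∘ₗ (j : m →ₗ[K] n) ∘ₗ hs.kernel.subtype
    have hf : f ≠ 0 := fun h0 => hZ ((hs.mem_range Z).2 fun Y hY => by
      obtain ⟨w, hw, rfl⟩ := hs.exists_mem_kernel hY
      exact LinearMap.congr_fun h0 ⟨w, hw⟩)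
    have hterm : ∀ y : idealSubgroup hs.isNullIdeal, θ (lam (conjMap (mapGroup j y) Z)) =
        θ (lam Z) * θ (f ((idealEquiv hs.isNullIdeal).symm y⁻¹)) := fun y => by
      have hy : j (tail (y : AlgebraGroup K m)) ∈ leftKernel lam := y.2
      rw [← AddChar.map_add_eq_mul]
      congr 1
      rw [conjMap_apply, map_add, map_add, map_add, mul_assoc, ← map_inv, tail_mapGroup,
        tail_mapGroup, hy, hy, add_zero, add_zero]
      rfl
    have hinv : ∑ y : idealSubgroup hs.isNullIdeal,
        θ (f ((idealEquiv hs.isNullIdeal).symm y⁻¹)) = ∑ w : hs.kernel, θ (f w) :=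
      Fintype.sum_equiv ((Equiv.inv _).trans (idealEquiv hs.isNullIdeal).symm) _ _ fun y => rfl
    rw [Finset.sum_congr rfl fun y _ => hterm y, ← Finset.mul_sum, hinv,
      sum_addChar_linear_eq_zero hθ hf, mul_zero]

/-- A sum over all of `G` absorbs left translations, so an average over `1 + l` can be inserted on
both sides. -/
lemma sum_extend_conjMap [IsNilpotentAlgebra K m] {θ : AddChar K ℂ} (hθ : θ ≠ 1) [Finite m]
    (X : n) :
    ∑ k : AlgebraGroup K n, Function.extend j (fun x => θ (mu x)) 0 (conjMap k X) =
      ∑ k : AlgebraGroup K n, θ (lam (conjMap k X)) := by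
  have := Fintype.ofFinite hs.kernel
  have := Fintype.ofFinite (idealSubgroup hs.isNullIdeal)
  have key : ∀ f : n → ℂ, ∑ k : AlgebraGroup K n,
      ∑ y : idealSubgroup hs.isNullIdeal, f (conjMap (mapGroup j y) (conjMap k X)) =
        Nat.card (idealSubgroup hs.isNullIdeal) * ∑ k : AlgebraGroup K n, f (conjMap k X) := by
    intro f
    rw [Finset.sum_comm]
    have : ∀ y : idealSubgroup hs.isNullIdeal,
        ∑ k : AlgebraGroup K n, f (conjMap (mapGroup j y) (conjMap k X)) =
          ∑ k : AlgebraGroup K n, f (conjMap k X) := fun y =>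
      Fintype.sum_equiv (Equiv.mulLeft (mapGroup j (y : AlgebraGroup K m))) _ _ fun k => by
        rw [Equiv.coe_mulLeft, conjMap_mul]
    simp only [this, Finset.sum_const, Finset.card_univ, nsmul_eq_mul, Nat.card_eq_fintype_card]
  have hN : (Nat.card (idealSubgroup hs.isNullIdeal) : ℂ) ≠ 0 :=
    Nat.cast_ne_zero.2 Nat.card_pos.ne'
  refine mul_left_cancel₀ hN ?_
  rw [← key, ← key fun Z => θ (lam Z)]
  exact Finset.sum_congr rfl fun k _ => (hs.sum_conjMap_idealSubgroup_eq hθ _).symm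

/-- The induction formula: the range of `j` is stable under `1 + m`, so extension by zero passes
inside the sum over `h`; each `h` is then absorbed by the sum over `G`, which yields the factor `|1
+ m|`. -/
lemma sum_extend_sum [IsNilpotentAlgebra K m] {θ : AddChar K ℂ} (hθ : θ ≠ 1) [Finite m]
    (c : ℂ) (X : n) :
    ∑ k : AlgebraGroup K n, Function.extend j
      (fun x => c * ∑ h : AlgebraGroup K m, θ (mu (conjMap h x))) 0 (conjMap k X) =
      Nat.card (AlgebraGroup K m) *
        (c * ∑ k : AlgebraGroup K n, θ (lam (conjMap k X))) := by
  have e : ∀ Z, Function.extend j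
      (fun x => c * ∑ h : AlgebraGroup K m, θ (mu (conjMap h x))) 0 Z =
      c * ∑ h : AlgebraGroup K m,
        Function.extend j (fun x => θ (mu x)) 0 (conjMap (mapGroup j h) Z) := by
    intro Z
    by_cases hZ : Z ∈ Set.range j
    · obtain ⟨x, rfl⟩ := hZ
      rw [hs.injective.extend_apply]
      simp only [hs.extend_conjMap]
    · rw [Function.extend_apply' _ _ _ hZ,
        Finset.sum_eq_zero fun h _ => hs.extend_conjMap_eq_zero θ h hZ, mul_zero]
      rfl
  simp only [e]
  rw [← Finset.mul_sum, Finset.sum_comm, mul_left_comm]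
  have : ∀ h : AlgebraGroup K m, ∑ k : AlgebraGroup K n,
      Function.extend j (fun x => θ (mu x)) 0 (conjMap (mapGroup j h) (conjMap k X)) =
        ∑ k : AlgebraGroup K n, θ (lam (conjMap k X)) := fun h => by
    rw [← hs.sum_extend_conjMap hθ]
    exact Fintype.sum_equiv (Equiv.mulLeft (mapGroup j h)) _ _ fun k => by
      rw [Equiv.coe_mulLeft, conjMap_mul]
  simp only [this, Finset.sum_const, Finset.card_univ, nsmul_eq_mul, Nat.card_eq_fintype_card]

end IsStep

end Step

/-! ### Twisted Kirillov functions under one step -/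

section Twist

variable {K n m : Type*} [Field K] [Finite K] [NonUnitalRing n] [Module K n]
  [IsScalarTower K n n] [SMulCommClass K n n] [NonUnitalRing m] [Module K m]
  [IsScalarTower K m m] [SMulCommClass K m m] [FiniteDimensional K n] [FiniteDimensional K m]
  [IsNilpotentAlgebra K n] [IsNilpotentAlgebra K m]
  (p : Polynomial K) (h0 : p.coeff 0 = 1) (h1 : p.coeff 1 = 1)

lemma twist_polyMap (ψ : AlgebraGroup K n → ℂ) (X : n) :
    twist (polyEquiv n p h0 h1) ψ (polyMap p X) = ψ (oneAdd K n X) :=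
  congrArg (fun Y => ψ (oneAdd K n Y)) ((polyEquiv n p h0 h1).symm_apply_apply X)

/-- `F` commutes with `j` and is bijective on both levels, so `F(Z)` lies in the image of `1 + m`
exactly when `Z` lies in that of `m`. -/
lemma extend_mapGroup_polyMap {j : m →ₙₐ[K] n} (hj : Function.Injective j)
    (ψ : AlgebraGroup K m → ℂ) (Z : n) :
    Function.extend (mapGroup j) (twist (polyEquiv m p h0 h1) ψ) 0 (polyMap p Z) =
      Function.extend j (fun x => ψ (oneAdd K m x)) 0 Z := by
  by_cases hZ : Z ∈ Set.range j
  · obtain ⟨x, rfl⟩ := hZ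
    rw [← mapGroup_polyMap p h0, (mapGroup_injective hj).extend_apply, twist_polyMap,
      hj.extend_apply]
  · rw [Function.extend_apply' _ _ _ hZ, Function.extend_apply']
    · rfl
    · rintro ⟨h, hh⟩
      obtain ⟨x, rfl⟩ := (polyMap_bijective p h0 h1).2 h
      rw [mapGroup_polyMap p h0] at hh
      exact hZ ⟨x, (polyMap_bijective p h0 h1).1 hh⟩

/-- The passage from `n` to the first subalgebra of the chain attached to `lam` preserves and
reflects irreducibility of the twisted Kirillov functions. -/
theorem IsStep.isIrrChar_iff {j : m →ₙₐ[K] n} {lam : Module.Dual K n} {mu : Module.Dual K m}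
    (hs : IsStep j lam mu) {θ : AddChar K ℂ} (hθ : θ ≠ 1) :
    IsIrrChar (twist (polyEquiv n p h0 h1) (kirillov θ lam)) ↔
      IsIrrChar (twist (polyEquiv m p h0 h1) (kirillov θ mu)) := by
  have : Finite n := Module.finite_of_finite K
  have : Finite m := Module.finite_of_finite K
  have := Fintype.ofFinite (AlgebraGroup K n)
  have := Fintype.ofFinite (AlgebraGroup K m)
  have := Fintype.ofFinite hs.kernel
  have hI := hs.isNullIdeal
  have := Fintype.ofFinite (idealSubgroup hI)
  set c : ℂ := ((Real.sqrt (Nat.card n * Nat.card (radical lam) : ℕ) : ℝ) : ℂ)⁻¹ with hc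
  have hc0 : c ≠ 0 := by
    rw [hc]
    refine inv_ne_zero (Complex.ofReal_ne_zero.2 (Real.sqrt_ne_zero'.2 ?_))
    exact_mod_cast Nat.mul_pos Nat.card_pos Nat.card_pos
  have hn : ∀ X, kirillov θ lam (oneAdd K n X) =
      c * ∑ g : AlgebraGroup K n, θ (lam (conjMap g X)) := fun X => kirillov_oneAdd θ lam X
  have hm : ∀ x, kirillov θ mu (oneAdd K m x) =
      c * ∑ h : AlgebraGroup K m, θ (mu (conjMap h x)) := fun x => by
    rw [hc, card_mul_card_radical hs.injective hs.map_apply hs.mem_range]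
    exact kirillov_oneAdd θ mu x
  have hone : twist (polyEquiv m p h0 h1) (kirillov θ mu) 1 =
      c * Nat.card (AlgebraGroup K m) := by
    rw [← polyMap_zero p h0, twist_polyMap, hm]
    simp
  refine isIrrChar_iff_of_mackey (N := idealSubgroup hI) (τ := idealChar hI θ)
    (mapGroup_injective hs.injective) (idealChar_conjNormal hI θ) (fun g hg => hs.mackey hθ g hg)
    _ _ (fun h => ?_) ?_ (fun y => ?_) (fun g => ?_)
  · obtain ⟨x, rfl⟩ := (polyMap_bijective p h0 h1).2 h
    -- Put `y = F(x)⁻¹ F(x + w)` in the average over `1 + l`: then `F(x) y = F(x + w)`, where the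
    -- twisted function is known.
    have hsum := (polyMap_inv_mul_bijective hI p h0 h1 x).sum_comp fun y : idealSubgroup hI =>
      idealChar hI θ y⁻¹ * twist (polyEquiv n p h0 h1) (kirillov θ lam)
        (mapGroup j (polyMap p x * y))
    rw [← hsum, twist_polyMap, hm, ← Nat.card_congr (idealEquiv hI)]
    have hterm : ∀ w : hs.kernel,
        idealChar hI θ (⟨(polyMap p x)⁻¹ * polyMap p (x + w),
          (hI.tail_polyMap_inv_mul p h0 h1 x w.2).1⟩ : idealSubgroup hI)⁻¹ *
        twist (polyEquiv n p h0 h1) (kirillov θ lam)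
          (mapGroup j (polyMap p x * ((polyMap p x)⁻¹ * polyMap p (x + w)))) =
        c * (θ (-mu w) * ∑ g : AlgebraGroup K n, θ (lam (conjMap g (j (x + w))))) := by
      intro w
      set y : idealSubgroup hI := ⟨(polyMap p x)⁻¹ * polyMap p (x + w),
          (hI.tail_polyMap_inv_mul p h0 h1 x w.2).1⟩
      have hy : idealChar hI θ y = θ (mu w) :=
        congrArg θ (hI.tail_polyMap_inv_mul p h0 h1 x w.2).2
      have hy' : idealChar hI θ y⁻¹ = θ (-mu w) := by
        refine mul_right_cancel₀ (θ.val_isUnit (mu w)).ne_zero ?_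
        rw [← hy, ← map_mul, inv_mul_cancel, map_one, hy, ← AddChar.map_add_eq_mul,
          neg_add_cancel, AddChar.map_zero_eq_one]
      rw [hy', mul_inv_cancel_left, mapGroup_polyMap p h0, twist_polyMap, hn, mul_left_comm]
    rw [Finset.sum_congr rfl fun w _ => hterm w, ← Finset.mul_sum, hs.sum_kernel_mul_sum hθ,
      mul_left_comm, inv_mul_cancel_left₀]
    exact Nat.cast_ne_zero.2 Nat.card_pos.ne'
  · rw [hone]
    exact mul_ne_zero hc0 (Nat.cast_ne_zero.2 Nat.card_pos.ne')
  -- The case `x = 0` writes `y` as `F(w)`; as `mu` is conjugation invariant on the kernel, all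
  -- terms of the group sum equal `τ y`.
  · obtain ⟨w, hw⟩ := (polyMap_inv_mul_bijective hI p h0 h1 0).2 y
    have hmu : mu (tail (y : AlgebraGroup K m)) = mu w := by
      rw [← hw]
      exact (hI.tail_polyMap_inv_mul p h0 h1 0 w.2).2
    have hy : (y : AlgebraGroup K m) = polyMap p (w : m) := by
      rw [← hw]
      change (polyMap p 0)⁻¹ * polyMap p (0 + (w : m)) = _
      rw [polyMap_zero p h0, inv_one, one_mul, zero_add]
    rw [hone, idealChar_apply, hmu, hy, twist_polyMap, hm]
    simp only [hI.map_conjMap_eq _ w.2, Finset.sum_const, Finset.card_univ, nsmul_eq_mul,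
      Nat.card_eq_fintype_card]
    ring
  · obtain ⟨X, rfl⟩ := (polyMap_bijective p h0 h1).2 g
    simp only [conj_polyMap p h0, extend_mapGroup_polyMap p h0 h1 hs.injective, hm,
      twist_polyMap, hn]
    exact hs.sum_extend_sum hθ c X

end Twist

/-! ### Iteration along the chain -/

section Chain

variable {K n : Type*} [Field K] [NonUnitalRing n] [Module K n]
  [IsScalarTower K n n] [SMulCommClass K n n]

lemma isStep_sChain_one (lam : Module.Dual K n) :
    IsStep (NonUnitalSubalgebraClass.subtype (sChain lam 1)) lam
      (restrictDual lam (sChain lam 1)) where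
  injective := Subtype.val_injective
  map_apply _ := rfl
  mem_range X := by
    constructor
    · rintro ⟨x, rfl⟩ Y hY
      exact x.2.2 Y ⟨trivial, fun Z _ => hY Z⟩
    · intro h
      exact ⟨⟨X, trivial, fun Y hY => h Y fun Z => hY.2 Z trivial⟩, rfl⟩

lemma isStep_nextSubalgebra (lam : Module.Dual K n) (s : NonUnitalSubalgebra K n) :
    IsStep (NonUnitalSubalgebra.inclusion (S := nextSubalgebra lam s) (T := s) fun _ hX => hX.1)
      (restrictDual lam s) (restrictDual lam (nextSubalgebra lam s)) where
  injective := NonUnitalSubalgebra.inclusion_injective _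
  map_apply _ := rfl
  mem_range X := by
    constructor
    · rintro ⟨x, rfl⟩ Y hY
      exact x.2.2 Y ⟨Y.2, fun Z hZ => hY ⟨Z, hZ⟩⟩
    · intro h
      exact ⟨⟨X, X.2, fun Y hY => h ⟨Y, hY.1⟩ fun Z => hY.2 Z Z.2⟩, rfl⟩

variable [Finite K] [FiniteDimensional K n] [IsNilpotentAlgebra K n]

/-- The index starts at `i + 1` because the zeroth term is `⊤` as a subalgebra, a different type
from `n`. -/
theorem isIrrChar_iff_sChain {θ : AddChar K ℂ} (hθ : θ ≠ 1) (p : Polynomial K)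
    (h0 : p.coeff 0 = 1) (h1 : p.coeff 1 = 1) (lam : Module.Dual K n) (i : ℕ) :
    IsIrrChar (twist (polyEquiv n p h0 h1) (kirillov θ lam)) ↔
      IsIrrChar (twist (polyEquiv (sChain lam (i + 1)) p h0 h1)
        (kirillov θ (restrictDual lam (sChain lam (i + 1))))) := by
  induction i with
  | zero => exact (isStep_sChain_one lam).isIrrChar_iff p h0 h1 hθ
  | succ i ih =>
    exact ih.trans ((isStep_nextSubalgebra lam (sChain lam (i + 1))).isIrrChar_iff p h0 h1 hθ)

end Chain

end AlgebraGroups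

theorem mainTheorem6 {K n : Type*} [Field K] [Finite K] [NonUnitalRing n] [Module K n]
    [IsScalarTower K n n] [SMulCommClass K n n] [FiniteDimensional K n]
    [AlgebraGroups.IsNilpotentAlgebra K n]
    (θ : AddChar K ℂ) (hθ : θ ≠ 1)
    (p : Polynomial K) (h0 : p.coeff 0 = 1) (h1 : p.coeff 1 = 1)
    (lam : Module.Dual K n) :
    AlgebraGroups.IsIrrChar
        (AlgebraGroups.twist (AlgebraGroups.polyEquiv n p h0 h1)
          (AlgebraGroups.kirillov θ lam)) ↔
      AlgebraGroups.IsIrrChar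
        (AlgebraGroups.twist (AlgebraGroups.polyEquiv (AlgebraGroups.sBar lam) p h0 h1)
          (AlgebraGroups.kirillov θ
            (AlgebraGroups.restrictDual lam (AlgebraGroups.sBar lam)))) := by
  obtain ⟨d, hd, hbar⟩ := AlgebraGroups.exists_sBar_eq_sChain lam
  -- Stationarity replaces the index `d`, possibly zero, by `d + 1`.
  rw [hbar, ← hd]
  exact AlgebraGroups.isIrrChar_iff_sChain hθ p h0 h1 lam d
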